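/- **Conventions.** Unprimed spinor indices $A,B,\dots\in\{0,1\}$ are raised and lowered with $\epsilon^{01}=\epsilon_{01}=1$, $\xi^A=\epsilon^{AB}\xi_B$, $\xi_B=\xi^A\epsilon_{AB}$. Let $M=S^3\times(0,1)$, $\bar M=S^3\times[0,1]$, $\mathscr I^-=S^3\times\{0\}$, $\mathscr I^+=S^3\times\{1\}$, $C_t=S^3\times\{t\}$, oriented so that $\partial \bar M=\mathscr I^+-\mathscr I^-$. All forms are smooth and complex-valued. Let $\Lambda,\kappa,\varepsilon$ be nonzero real numbers. **Background.** Let $(\Sigma_0^{AB},\Gamma_{0\,AB})$, symmetric in $AB$, be a self-dual solution of the Plebanski equations on $M$: with $\mathrm D_0$ the covariant derivative of $\Gamma_0$ ($\mathrm D_0X^{AB}=\mathrm dX^{AB}+2\Gamma^{(A}_{0\,C}\wedge X^{B)C}$) and $F_0$ its curvature, $$\mathrm D_0\Sigma_0^{AB}=0,\qquad F_{0\,AB}=\tfrac{\Lambda}{3}\Sigma_{0\,AB},\qquad \Sigma_0^{(AB}\wedge\Sigma_0^{CD)}=0,$$ with nowhere vanishing volume form $\mathrm d\mu$ normalised by $\Sigma_0^{AB}\wedge\Sigma_{0\,AB}=6\,\mathrm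 d\mu$. Assume that it has a smooth conformal compactification: there is a real $\Omega\in C^\infty(\bar M)$ with $\Omega\ne0$ on $M$, $\Omega=0$ and $\mathrm d\Omega\neq0$ on $\partial\bar M$, such that $\Omega^2\Sigma_0^{AB}$ extends to $\bar M$, smooth and nondegenerate. **States.** For $i=1,2$ let $h_i=(\sigma_i^{AB},\gamma_{i\,AB})$, symmetric in $AB$, with a totally symmetric spinor field $\psi_{i\,ABCD}$ (the linearized Weyl spinor), solve the linearized Einstein equations $$\mathrm D_0\sigma_i^{AB}=-2\gamma^{(A}_{i\,C}\wedge\Sigma_0^{B)C},\qquad \mathrm D_0\gamma_{i\,AB}=\psi_{i\,ABCD}\Sigma_0^{CD}+\tfrac{\Lambda}{3}\sigma_{i\,AB},\qquad \sigma_i^{(AB}\wedge\Sigma_0^{CD)}=0$$ on $M$, and assume that $\Omega^2\sigma_i$ and $\Omega^{-2}\psi_i$ extend smoothly to $\bar M$. Call $h$ anti-self-dual at $\mathscr I^{\pm}$ if $\sigma$ extends smoothly to $M\cup\mathscr I^\pm$ and $\int_{C_t}\sigma^{AB}\wedge\gamma_{AB}\to0$, as $C_t\to\mathscr I^\pm$,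 for all symmetric families $\gamma_{AB}$ of $1$-forms smooth on $\bar M$. Assume that $h_1$ is anti-self-dual at $\mathscr I^-$ and $h_2$ is anti-self-dual at $\mathscr I^+$. **Generating functionals.** The Einstein one is $I^{\mathrm{GR}}[1^-,2^-,M^+]=\langle h_2|h_1\rangle$, where $$\langle h_i|h_j\rangle=-\frac{i}{\kappa^2}\int_{C_t}\bigl(\sigma_j^{AB}\wedge\gamma_{i\,AB}-\sigma_i^{AB}\wedge\gamma_{j\,AB}\bigr)$$ is the inner product induced by the symplectic form $\kappa^{-2}\int_C\delta\Sigma^{AB}\wedge\delta\Gamma_{AB}$. The conformal gravity one is $$I^{\mathrm{CG}}[1^-,2^-,M^+]=\frac{2i}{\varepsilon^2}\int_M\mathrm d\mu\;\psi_1^{ABCD}\psi_{2\,ABCD}.$$ **Proposition.** The integral defining $I^{\mathrm{CG}}$ converges absolutely and, for every slice $C_t$, $0<t<1$ (so that $I^{\mathrm{GR}}$ does not depend on the slice, and its limit at $\mathscr I^+$ has the same value), $$I^{\mathrm{GR}}[1^-,2^-,M^+]=-\frac{3\varepsilon^2}{\Lambda\kappa^2}\,I^{\mathrm{CG}}[1^-,2^-,M^+].$$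 -/

import Mathlib

open MeasureTheory Set Filter Topology
open scoped ContDiff

noncomputable section

namespace MHV

/-! ### Differential forms on open subsets of `ℝ⁴` -/

/-- `ℝ⁴` with its Euclidean structure; it only serves to carry the manifold `S³ × (0,1)`. -/
abbrev E4 : Type := EuclideanSpace ℝ (Fin 4)

/-- Complex-valued exterior `p`-covectors on `ℝ⁴`. -/
abbrev Cov (p : ℕ) : Type := E4 [⋀^Fin p]→L[ℝ] ℂ

/-- Complex-valued differential `p`-forms. -/
abbrev Form (p : ℕ) : Type := E4 → Cov p

/-- The multilinear map `(v₁, …, v_{p+q}) ↦ α (v₁, …, v_p) * β (v_{p+1}, …, v_{p+q})`. -/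
def tensorCov {p q n : ℕ} (h : p + q = n) (α : Cov p) (β : Cov q) :
    ContinuousMultilinearMap ℝ (fun _ : Fin n => E4) ℂ where
  toMultilinearMap :=
    ((LinearMap.mul' ℝ ℂ).compMultilinearMap
      (MultilinearMap.domCoprod α.toMultilinearMap β.toMultilinearMap)).domDomCongr
        (finSumFinEquiv.trans (finCongr h))
  cont := by
    subst h
    change Continuous fun v : Fin (p + q) → E4 =>
      α (fun i => v (Fin.castAdd q i)) * β (fun j => v (Fin.natAdd p j))
    fun_prop

/-- The wedge product of exterior covectors,
`(α ∧ β)(v) = 1 / (p! q!) ∑_π sign π · α (v_{π 1}, …, v_{π p}) · β (v_{π (p+1)}, …, v_{π (p+q)})`. -/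
def wedgeCov {p q n : ℕ} (h : p + q = n) (α : Cov p) (β : Cov q) : Cov n :=
  (1 / ((p.factorial : ℝ) * (q.factorial : ℝ))) •
    ContinuousMultilinearMap.alternatization (tensorCov h α β)

theorem wedgeCov_apply {p q : ℕ} (α : Cov p) (β : Cov q) (v : Fin (p + q) → E4) :
    wedgeCov rfl α β v = (1 / ((p.factorial : ℝ) * (q.factorial : ℝ))) •
      ∑ π : Equiv.Perm (Fin (p + q)), Equiv.Perm.sign π •
        (α (fun i => v (π (Fin.castAdd q i))) * β (fun j => v (π (Fin.natAdd p j)))) := by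
  simp only [wedgeCov, ContinuousAlternatingMap.smul_apply,
    ContinuousMultilinearMap.alternatization_apply_apply]
  rfl

/-- The wedge product of differential forms. -/
def wedge {p q n : ℕ} (h : p + q = n) (α : Form p) (β : Form q) : Form n :=
  fun x => wedgeCov h (α x) (β x)

/-! ### The manifold `M ≃ S³ × (0,1)` and integration on it

`M` is realised as the open shell `1 < ‖x‖ < 2` in `ℝ⁴`, through `x ↦ (x / ‖x‖, ‖x‖ - 1)`.
Its compactification is the closed shell; past infinity is the sphere of radius `1`, future
infinity the sphere of radius `2`, and the Cauchy slices are the spheres of radius `r`,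
`1 < r < 2`. -/

/-- The space-time manifold. -/
def M : Set E4 := {x | 1 < ‖x‖ ∧ ‖x‖ < 2}

/-- The compactified space-time `S³ × [0,1]`. -/
def Mbar : Set E4 := {x | 1 ≤ ‖x‖ ∧ ‖x‖ ≤ 2}

/-- The component of the conformal boundary at radius `ρ` (`ρ = 1` past, `ρ = 2` future). -/
def scri (ρ : ℝ) : Set E4 := Metric.sphere 0 ρ

/-- Standard basis of `ℝ⁴`. -/
def stdB (i : Fin 4) : E4 := EuclideanSpace.single i (1 : ℝ)

/-- The coefficient of a `4`-covector with respect to `dx⁰ ∧ dx¹ ∧ dx² ∧ dx³`. -/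
def topCoeff (μ : Cov 4) : ℂ := μ stdB

/-- The integral of a `3`-form over the sphere of radius `r`, oriented as the boundary of the ball
(outward normal first): in terms of the unit normal `u`, the restriction of `β` to the sphere is
`∑ⱼ (-1)ʲ uⱼ β(e₀, …, êⱼ, …, e₃)` times the Euclidean area element. -/
def sliceIntegral (r : ℝ) (β : Form 3) : ℂ :=
  ∫ u : Metric.sphere (0 : E4) 1,
    ((r ^ 3 : ℝ) : ℂ) * ∑ j : Fin 4, (-1) ^ (j : ℕ) * (((u : E4) j : ℝ) : ℂ) *
      β (r • (u : E4)) (fun k => stdB (j.succAbove k))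
    ∂((volume : Measure E4).toSphere)

/-- `f` is, on `s`, the restriction of a map that is smooth on the larger set `t`. -/
def ExtendsSmoothly {V : Type*} [NormedAddCommGroup V] [NormedSpace ℝ V]
    (f : E4 → V) (s t : Set E4) : Prop :=
  ∃ g : E4 → V, ContDiffOn ℝ ∞ g t ∧ EqOn g f s

/-! ### Two-component spinor indices

Conventions: `ε^{01} = ε_{01} = 1`, `ξ^A = ε^{AB} ξ_B`, `ξ_B = ξ^A ε_{AB}`. -/

/-- The spinor symbol, `ε^{AB}` as well as `ε_{AB}`. -/
def eps (A B : Fin 2) : ℂ := !![(0 : ℂ), 1; -1, 0] A B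

/-- A pair of (upper or lower) spinor indices carrying a `p`-form. -/
abbrev SForm (p : ℕ) : Type := Fin 2 → Fin 2 → Form p

/-- `X_{AB} = X^{CD} ε_{CA} ε_{DB}`. -/
def lower {p : ℕ} (X : SForm p) : SForm p :=
  fun A B x => ∑ C, ∑ D, (eps C A * eps D B) • X C D x

/-- `X^A_B = ε^{AC} X_{CB}`. -/
def raiseFirst {p : ℕ} (X : SForm p) : SForm p :=
  fun A B x => ∑ C, eps A C • X C B x

/-- `X^{AB} ∧ Y_{AB}`. -/
def contract {p q n : ℕ} (h : p + q = n) (X : SForm p) (Y : SForm q) : Form n :=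
  fun x => ∑ A, ∑ B, wedge h (X A B) (Y A B) x

/-- `2 γ^{(A}_C ∧ X^{B)C} = γ^A_C ∧ X^{BC} + γ^B_C ∧ X^{AC}` for a connection-type field `γ_{AB}` and
a field `X^{AB}` with upper indices. -/
def actUpper {p : ℕ} (γ : SForm 1) (X : SForm p) : SForm (p + 1) :=
  fun A B x => ∑ C, (wedge (Nat.add_comm 1 p) (raiseFirst γ A C) (X B C) x +
    wedge (Nat.add_comm 1 p) (raiseFirst γ B C) (X A C) x)

/-- `2 Γ_{C(A} ∧ X^C_{B)} = Γ_{CA} ∧ X^C_B + Γ_{CB} ∧ X^C_A` for a field `X_{AB}` with lower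
indices. -/
def actLower {p : ℕ} (Γ : SForm 1) (X : SForm p) : SForm (p + 1) :=
  fun A B x => ∑ C, (wedge (Nat.add_comm 1 p) (Γ C A) (raiseFirst X C B) x +
    wedge (Nat.add_comm 1 p) (Γ C B) (raiseFirst X C A) x)

/-- `D X^{AB} = d X^{AB} + 2 Γ^{(A}_C ∧ X^{B)C}`. -/
def covDUpper {p : ℕ} (Γ : SForm 1) (X : SForm p) : SForm (p + 1) :=
  fun A B x => extDeriv (X A B) x + actUpper Γ X A B x

/-- `D X_{AB} = d X_{AB} + 2 Γ_{C(A} ∧ X^C_{B)}`. -/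
def covDLower {p : ℕ} (Γ : SForm 1) (X : SForm p) : SForm (p + 1) :=
  fun A B x => extDeriv (X A B) x + actLower Γ X A B x

/-- The curvature `F_{AB} = d Γ_{AB} + Γ_{CA} ∧ Γ^C_B` of the connection `D`. -/
def curvature (Γ : SForm 1) : SForm 2 :=
  fun A B x => extDeriv (Γ A B) x + ∑ C, wedge rfl (Γ C A) (raiseFirst Γ C B) x

/-- The total symmetrisation (up to the factor `1/4!`) of `X^{AB} ∧ Y^{CD}`. -/
def symWedge (X Y : SForm 2) (I : Fin 4 → Fin 2) : Form 4 :=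
  fun x => ∑ π : Equiv.Perm (Fin 4),
    wedge rfl (X (I (π 0)) (I (π 1))) (Y (I (π 2)) (I (π 3))) x

/-- The volume form of the chiral formulation: `Σ^{AB} ∧ Σ_{AB} = 6 dμ`, which for a `Σ` with
`Σ^{(AB} ∧ Σ^{CD)} = 0` says `Σ^{AB} ∧ Σ^{CD} = (ε^{AC} ε^{BD} + ε^{AD} ε^{BC}) dμ`. -/
def volForm (S : SForm 2) : Form 4 :=
  fun x => (1 / 6 : ℂ) • contract (n := 4) rfl S (lower S) x

/-- Fields `ψ_{ABCD}` with four lower spinor indices. -/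
abbrev Spinor4 : Type := E4 → (Fin 4 → Fin 2) → ℂ

/-- `ψ_{ABCD} Σ^{CD}`. -/
def weylForm (ψ : Spinor4) (S : SForm 2) : SForm 2 :=
  fun A B x => ∑ C, ∑ D, ψ x ![A, B, C, D] • S C D x

/-- `φ^{ABCD} χ_{ABCD}`, at a point. -/
def contract4 (φ χ : (Fin 4 → Fin 2) → ℂ) : ℂ :=
  ∑ I : Fin 4 → Fin 2, ∑ J : Fin 4 → Fin 2, (∏ k, eps (I k) (J k)) * φ J * χ I

/-! ### Self-dual backgrounds -/

/-- A (complex) self-dual solution `(Σ₀^{AB}, Γ₀_{AB})` of the Plebanski equations on `M` with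
cosmological constant `Λ`: the field equations with vanishing anti-self-dual Weyl spinor. -/
structure IsSelfDualBackground (Λ : ℝ) (S : SForm 2) (Γ : SForm 1) : Prop where
  symm_S : ∀ A B, S A B = S B A
  symm_Γ : ∀ A B, Γ A B = Γ B A
  smooth_S : ∀ A B, ContDiffOn ℝ ∞ (S A B) M
  smooth_Γ : ∀ A B, ContDiffOn ℝ ∞ (Γ A B) M
  /-- `D Σ^{AB} = 0`. -/
  torsion_free : ∀ A B, ∀ x ∈ M, covDUpper Γ S A B x = 0
  /-- `F_{AB} = (Λ/3) Σ_{AB}`. -/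
  curvature_eq : ∀ A B, ∀ x ∈ M, curvature Γ A B x = ((Λ / 3 : ℝ) : ℂ) • lower S A B x
  /-- `Σ^{(AB} ∧ Σ^{CD)} = 0`. -/
  simplicity : ∀ I, ∀ x ∈ M, symWedge S S I x = 0
  nondegenerate : ∀ x ∈ M, volForm S x ≠ 0

/-- Smooth conformal compactification with conformal factor `Ω`: the rescaled metric `Ω² g`, that is
`Ω² Σ₀`, is smooth and nondegenerate up to the boundary, and `Ω` is a defining function of the
boundary. -/
structure IsConformalCompactification (Ω : E4 → ℝ) (S : SForm 2) : Prop where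
  smooth : ContDiffOn ℝ ∞ Ω Mbar
  ne_zero : ∀ x ∈ M, Ω x ≠ 0
  eq_zero : ∀ x ∈ scri 1 ∪ scri 2, Ω x = 0
  deriv_ne_zero : ∀ x ∈ scri 1 ∪ scri 2, fderivWithin ℝ Ω Mbar x ≠ 0
  rescaled : ∃ S' : SForm 2, (∀ A B, ContDiffOn ℝ ∞ (S' A B) Mbar) ∧
    (∀ A B, ∀ x ∈ M, S' A B x = (Ω x ^ 2) • S A B x) ∧ ∀ x ∈ Mbar, volForm S' x ≠ 0

/-! ### Linearised Einstein states on the background -/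

/-- A perturbation `h = (σ^{AB}, γ_{AB})` with its linearised Weyl spinor `ψ_{ABCD}`. -/
structure Perturbation where
  σ : SForm 2
  γ : SForm 1
  ψ : Spinor4

/-- `h` is an Einstein scattering state: a smooth solution of the linearised Plebanski equations whose
perturbation `Ω² σ` of the rescaled `Ω² Σ₀` and whose linearised Weyl spinor `Ω⁻² ψ` relative to
`Ω² Σ₀` (so that `ψ_{ABCD} Σ^{CD}` is unchanged) are smooth up to the conformal boundary. -/
structure IsScatteringState (Λ : ℝ) (S : SForm 2) (Γ : SForm 1) (Ω : E4 → ℝ)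
    (h : Perturbation) : Prop where
  symm_σ : ∀ A B, h.σ A B = h.σ B A
  symm_γ : ∀ A B, h.γ A B = h.γ B A
  symm_ψ : ∀ x, ∀ (π : Equiv.Perm (Fin 4)) (I : Fin 4 → Fin 2), h.ψ x (I ∘ π) = h.ψ x I
  smooth_σ : ∀ A B, ContDiffOn ℝ ∞ (h.σ A B) M
  smooth_γ : ∀ A B, ContDiffOn ℝ ∞ (h.γ A B) M
  smooth_ψ : ContDiffOn ℝ ∞ h.ψ M
  /-- `D₀ σ^{AB} = - 2 γ^{(A}_C ∧ Σ₀^{B)C}`. -/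
  lin_torsion : ∀ A B, ∀ x ∈ M, covDUpper Γ h.σ A B x = - actUpper h.γ S A B x
  /-- `D₀ γ_{AB} = ψ_{ABCD} Σ₀^{CD} + (Λ/3) σ_{AB}`. -/
  lin_curvature : ∀ A B, ∀ x ∈ M,
    covDLower Γ h.γ A B x = weylForm h.ψ S A B x + ((Λ / 3 : ℝ) : ℂ) • lower h.σ A B x
  /-- `σ^{(AB} ∧ Σ₀^{CD)} = 0`. -/
  lin_simplicity : ∀ I, ∀ x ∈ M, symWedge h.σ S I x = 0
  regular_σ : ∀ A B, ExtendsSmoothly (fun x => (Ω x ^ 2) • h.σ A B x) M Mbar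
  regular_ψ : ExtendsSmoothly (fun x => (Ω x ^ 2)⁻¹ • h.ψ x) M Mbar

/-- `h` is anti-self-dual at the component `scri ρ` of the conformal boundary: `σ` has a smooth
boundary value there, and `∫_{C_r} σ^{AB} ∧ γ_{AB} → 0` as the slices `C_r` approach `scri ρ`, for
all `γ_{AB}` smooth up to the boundary. -/
def IsASDAt (ρ : ℝ) (h : Perturbation) : Prop :=
  (∀ A B, ExtendsSmoothly (h.σ A B) M (M ∪ scri ρ)) ∧
  ∀ γ : SForm 1, (∀ A B, γ A B = γ B A) → (∀ A B, ContDiffOn ℝ ∞ (γ A B) Mbar) →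
    Tendsto (fun r : ℝ => sliceIntegral r (contract (n := 3) rfl h.σ γ)) (𝓝[Ioo 1 2] ρ) (𝓝 0)

/-! ### The generating functionals -/

/-- The inner product `⟨h_i | h_j⟩ = -(i/κ²) ∫_C (σ_j^{AB} ∧ γ_{i AB} - σ_i^{AB} ∧ γ_{j AB})` on the
slice `C` of radius `r`, induced by the symplectic form `κ⁻² ∫_C δΣ^{AB} ∧ δΓ_{AB}`. -/
def innerProduct (κ r : ℝ) (hi hj : Perturbation) : ℂ :=
  -(Complex.I / (κ : ℂ) ^ 2) *
    sliceIntegral r (fun x => contract (n := 3) rfl hj.σ hi.γ x - contract (n := 3) rfl hi.σ hj.γ x)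

/-- The Einstein generating functional `I^GR[1⁻, 2⁻, M⁺] = ⟨h₂ | h₁⟩`, evaluated on the slice of
radius `r`. -/
def IGR (κ r : ℝ) (h₁ h₂ : Perturbation) : ℂ := innerProduct κ r h₂ h₁

/-- The integrand of `∫_M dμ ψ₁^{ABCD} ψ₂_{ABCD}`. -/
def cgDensity (S : SForm 2) (h₁ h₂ : Perturbation) (x : E4) : ℂ :=
  contract4 (h₁.ψ x) (h₂.ψ x) * topCoeff (volForm S x)

/-- The conformal gravity generating functional
`I^CG[1⁻, 2⁻, M⁺] = (2i/ε²) ∫_M dμ ψ₁^{ABCD} ψ₂_{ABCD}`. -/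
def ICG (ε : ℝ) (S : SForm 2) (h₁ h₂ : Perturbation) : ℂ :=
  (2 * Complex.I / (ε : ℂ) ^ 2) * ∫ x in M, cgDensity S h₁ h₂ x

end MHV

end

/-!
Let `Ψ_{AB} = ψ_{ABCD} Σ₀^{CD}` be the two-form valued linearised Weyl spinor of a state `h`, and
for two states consider the three-form `J(h, h') = γ_{AB} ∧ Ψ'^{AB}`. Applying `D₀` to the
linearised curvature equation and comparing with the Ricci identity gives `D₀ Ψ' = 0`, while the
linearised simplicity constraint gives `σ_{AB} ∧ Ψ'^{AB} = 0`; hence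
`dJ(h, h') = 2 ψ^{ABCD} ψ'_{ABCD} dμ`. Substituting the curvature equation for `Ψ` and `Ψ'` instead
shows that `J(h', h) - J(h, h')` is exact up to `-Λ/3` times the symplectic current.

At a boundary component where `σ` is regular, `γ = O(Ω)`: the background connection has at most a
simple pole, and the torsion map `γ ↦ γ ∧ Σ` of the rescaled background is invertible uniformly up
to the boundary. Since `Ψ` is smooth up to the boundary, `J(h, h')` then has no flux through that
component. Stokes' theorem on either side of a slice, for `J(h₁, h₂)` towards the past and for
`J(h₂, h₁)` towards the future, expresses the symplectic flux by two halves of the conformal gravity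
integral which add up to the integral over all of `M`.
-/

noncomputable section

namespace MHV

/-! ### Evaluation of wedge products -/

theorem sum_perm_fin_three {V : Type*} [AddCommMonoid V] (f : ℤˣ → Fin 3 → Fin 3 → Fin 3 → V) :
    ∑ π : Equiv.Perm (Fin 3), f (Equiv.Perm.sign π) (π 0) (π 1) (π 2) =
      f 1 0 1 2 + f (-1) 0 2 1 + f (-1) 1 0 2 + f 1 1 2 0 + f 1 2 0 1 + f (-1) 2 1 0 := by
  have symm_apply_two (p : Fin 3) (e : Equiv.Perm (Fin 2)) :
      Equiv.Perm.decomposeFin.symm (p, e) 2 = Equiv.swap 0 p (e 1).succ :=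
    Equiv.Perm.decomposeFin_symm_apply_succ e p 1
  simp [Finset.univ_perm_fin_succ, Finset.sum_map, ← Finset.univ_product_univ, Finset.sum_product,
    Fin.sum_univ_succ, symm_apply_two, Equiv.swap_apply_def]
  abel

theorem sum_perm_fin_four {V : Type*} [AddCommMonoid V]
    (f : ℤˣ → Fin 4 → Fin 4 → Fin 4 → Fin 4 → V) :
    ∑ π : Equiv.Perm (Fin 4), f (Equiv.Perm.sign π) (π 0) (π 1) (π 2) (π 3) =
      (f 1 0 1 2 3 + f (-1) 0 1 3 2 + f (-1) 0 2 1 3 + f 1 0 2 3 1 + f 1 0 3 1 2 +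
        f (-1) 0 3 2 1) +
      (f (-1) 1 0 2 3 + f 1 1 0 3 2 + f 1 1 2 0 3 + f (-1) 1 2 3 0 + f (-1) 1 3 0 2 +
        f 1 1 3 2 0) +
      (f 1 2 0 1 3 + f (-1) 2 0 3 1 + f (-1) 2 1 0 3 + f 1 2 1 3 0 + f 1 2 3 0 1 +
        f (-1) 2 3 1 0) +
      (f (-1) 3 0 1 2 + f 1 3 0 2 1 + f 1 3 1 0 2 + f (-1) 3 1 2 0 + f (-1) 3 2 0 1 +
        f 1 3 2 1 0) := by
  have symm_apply_two (p : Fin 4) (e : Equiv.Perm (Fin 3)) :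
      Equiv.Perm.decomposeFin.symm (p, e) 2 = Equiv.swap 0 p (e 1).succ :=
    Equiv.Perm.decomposeFin_symm_apply_succ e p 1
  have symm_apply_three (p : Fin 4) (e : Equiv.Perm (Fin 3)) :
      Equiv.Perm.decomposeFin.symm (p, e) 3 = Equiv.swap 0 p (e 2).succ :=
    Equiv.Perm.decomposeFin_symm_apply_succ e p 2
  have sum_tail (p : Fin 4) := sum_perm_fin_three
    (fun s i j k => f ((if p = 0 then 1 else -1) * s) p (Equiv.swap 0 p i.succ)
      (Equiv.swap 0 p j.succ) (Equiv.swap 0 p k.succ))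
  rw [Finset.univ_perm_fin_succ, Finset.sum_map, ← Finset.univ_product_univ, Finset.sum_product]
  simp only [Equiv.coe_toEmbedding, Equiv.Perm.decomposeFin.symm_sign, symm_apply_two,
    symm_apply_three, Equiv.Perm.decomposeFin_symm_apply_zero,
    Equiv.Perm.decomposeFin_symm_apply_one, sum_tail, Fin.sum_univ_four]
  simp only [↓reduceIte, mul_one, Equiv.swap_self, Fin.succ_zero_eq_one, Equiv.refl_apply,
    Fin.succ_one_eq_two, Fin.reduceSucc, mul_neg, one_ne_zero, Equiv.swap_apply_right,
    Equiv.swap_apply_def, Fin.ext_iff, Fin.isValue, Nat.reduceAdd, Fin.coe_ofNat_eq_mod,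
    Nat.reduceMod, Nat.zero_mod, OfNat.ofNat_ne_zero, Nat.one_mod, OfNat.ofNat_ne_one, Nat.mod_succ,
    neg_neg, OfNat.one_ne_ofNat, OfNat.ofNat_eq_ofNat, Nat.succ_ne_self, Nat.reduceEqDiff]
  abel

theorem vec_one_eta {E : Type*} (v : Fin 1 → E) : v = ![v 0] := (FinVec.etaExpand_eq v).symm

theorem vec_two_eta {E : Type*} (v : Fin 2 → E) : v = ![v 0, v 1] := (FinVec.etaExpand_eq v).symm

theorem vec_three_eta {E : Type*} (v : Fin 3 → E) : v = ![v 0, v 1, v 2] :=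
  (FinVec.etaExpand_eq v).symm

theorem vec_four_eta {E : Type*} (v : Fin 4 → E) : v = ![v 0, v 1, v 2, v 3] :=
  (FinVec.etaExpand_eq v).symm

theorem cov_three_ext {α β : Cov 3} (h : ∀ u v w, α ![u, v, w] = β ![u, v, w]) : α = β := by
  ext v
  rw [vec_three_eta v]
  exact h _ _ _

theorem cov_four_ext {α β : Cov 4} (h : ∀ u v w z, α ![u, v, w, z] = β ![u, v, w, z]) : α = β := by
  ext v
  rw [vec_four_eta v]
  exact h _ _ _ _

theorem cov_two_swap (α : Cov 2) (u v : E4) : α ![v, u] = -α ![u, v] := by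
  refine Eq.trans (congrArg α ?_) (α.map_swap ![u, v] (show (0 : Fin 2) ≠ 1 by decide))
  ext i : 1
  fin_cases i <;> rfl

theorem cov_three_perm (β : Cov 3) (u v w : E4) :
    β ![u, w, v] = -β ![u, v, w] ∧ β ![v, u, w] = -β ![u, v, w] ∧ β ![w, v, u] = -β ![u, v, w] ∧
      β ![v, w, u] = β ![u, v, w] ∧ β ![w, u, v] = β ![u, v, w] := by
  have swap_right (a b c : E4) : β ![a, c, b] = -β ![a, b, c] := by
    refine Eq.trans (congrArg β ?_) (β.map_swap ![a, b, c] (show (1 : Fin 3) ≠ 2 by decide))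
    ext i : 1
    fin_cases i <;> rfl
  have swap_left (a b c : E4) : β ![b, a, c] = -β ![a, b, c] := by
    refine Eq.trans (congrArg β ?_) (β.map_swap ![a, b, c] (show (0 : Fin 3) ≠ 1 by decide))
    ext i : 1
    fin_cases i <;> rfl
  refine ⟨swap_right u v w, swap_left u v w, ?_, ?_, ?_⟩
  · rw [swap_left v w u, swap_right v u w, swap_left u v w, neg_neg]
  · rw [swap_right v u w, swap_left u v w, neg_neg]
  · rw [swap_left u w v, swap_right u v w, neg_neg]

theorem wedgeCov_one_one (h : 1 + 1 = 2) (α β : Cov 1) (u v : E4) :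
    wedgeCov h α β ![u, v] = α ![u] * β ![v] - α ![v] * β ![u] := by
  refine (wedgeCov_apply α β ![u, v]).trans ?_
  have split_args (π : Equiv.Perm (Fin 2)) :
      α (fun i => ![u, v] (π (Fin.castAdd 1 i))) *
          β (fun j => ![u, v] (π (Fin.natAdd 1 j))) =
        α ![![u, v] (π 0)] *
          β ![![u, v] (π 1)] :=
    congrArg₂ _ (congrArg α (vec_one_eta _)) (congrArg β (vec_one_eta _))
  simp only [split_args]
  simp [Finset.univ_perm_fin_succ, Finset.sum_map, ← Finset.univ_product_univ,
    Fin.sum_univ_succ, sub_eq_add_neg]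

theorem wedgeCov_one_two (h : 1 + 2 = 3) (α : Cov 1) (β : Cov 2) (u v w : E4) :
    wedgeCov h α β ![u, v, w] =
      α ![u] * β ![v, w] - α ![v] * β ![u, w] + α ![w] * β ![u, v] := by
  refine (wedgeCov_apply α β ![u, v, w]).trans ?_
  have split_args (π : Equiv.Perm (Fin 3)) :
      α (fun i => ![u, v, w] (π (Fin.castAdd 2 i))) *
          β (fun j => ![u, v, w] (π (Fin.natAdd 1 j))) =
        α ![![u, v, w] (π 0)] *
          β ![![u, v, w] (π 1), ![u, v, w] (π 2)] :=
    congrArg₂ _ (congrArg α (vec_one_eta _)) (congrArg β (vec_two_eta _))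
  simp only [split_args]
  refine (congrArg _ (sum_perm_fin_three fun s i j k =>
    s • (α ![![u, v, w] i] * β ![![u, v, w] j, ![u, v, w] k]))).trans ?_
  simp only [Nat.factorial, Nat.succ_eq_add_one, zero_add, mul_one, Nat.cast_one, Nat.reduceAdd,
    Nat.cast_ofNat, one_mul, one_div, Matrix.cons_val, one_smul, cov_two_swap β v w,
    cov_two_swap β u w, cov_two_swap β u v, mul_neg, smul_neg, Units.neg_smul, neg_neg, smul_add,
    Complex.real_smul, Complex.ofReal_inv, Complex.ofReal_ofNat]
  ring

theorem wedgeCov_two_one (h : 2 + 1 = 3) (α : Cov 2) (β : Cov 1) (u v w : E4) :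
    wedgeCov h α β ![u, v, w] =
      α ![u, v] * β ![w] - α ![u, w] * β ![v] + α ![v, w] * β ![u] := by
  refine (wedgeCov_apply α β ![u, v, w]).trans ?_
  have split_args (π : Equiv.Perm (Fin 3)) :
      α (fun i => ![u, v, w] (π (Fin.castAdd 1 i))) *
          β (fun j => ![u, v, w] (π (Fin.natAdd 2 j))) =
        α ![![u, v, w] (π 0), ![u, v, w] (π 1)] *
          β ![![u, v, w] (π 2)] :=
    congrArg₂ _ (congrArg α (vec_two_eta _)) (congrArg β (vec_one_eta _))
  simp only [split_args]
  refine (congrArg _ (sum_perm_fin_three fun s i j k =>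
    s • (α ![![u, v, w] i, ![u, v, w] j] * β ![![u, v, w] k]))).trans ?_
  simp only [Nat.factorial, Nat.succ_eq_add_one, Nat.reduceAdd, zero_add, mul_one, Nat.cast_ofNat,
    Nat.cast_one, one_div, Matrix.cons_val, one_smul, Units.neg_smul, cov_two_swap α u v,
    cov_two_swap α u w, cov_two_swap α v w, neg_mul, smul_neg, neg_neg, smul_add,
    Complex.real_smul, Complex.ofReal_inv, Complex.ofReal_ofNat]
  ring

theorem wedgeCov_two_two (h : 2 + 2 = 4) (α β : Cov 2) (u v w z : E4) :
    wedgeCov h α β ![u, v, w, z] =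
      α ![u, v] * β ![w, z] - α ![u, w] * β ![v, z] + α ![u, z] * β ![v, w] +
      α ![v, w] * β ![u, z] - α ![v, z] * β ![u, w] + α ![w, z] * β ![u, v] := by
  refine (wedgeCov_apply α β ![u, v, w, z]).trans ?_
  have split_args (π : Equiv.Perm (Fin 4)) :
      α (fun i => ![u, v, w, z] (π (Fin.castAdd 2 i))) *
          β (fun j => ![u, v, w, z] (π (Fin.natAdd 2 j))) =
        α ![![u, v, w, z] (π 0), ![u, v, w, z] (π 1)] *
          β ![![u, v, w, z] (π 2), ![u, v, w, z] (π 3)] :=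
    congrArg₂ _ (congrArg α (vec_two_eta _)) (congrArg β (vec_two_eta _))
  simp only [split_args]
  refine (congrArg _ (sum_perm_fin_four fun s i j k l => s •
    (α ![![u, v, w, z] i, ![u, v, w, z] j] * β ![![u, v, w, z] k, ![u, v, w, z] l]))).trans ?_
  simp [cov_two_swap α v w, cov_two_swap α u w, cov_two_swap α u v, cov_two_swap α u z,
    cov_two_swap α v z, cov_two_swap α w z, cov_two_swap β v w, cov_two_swap β u w,
    cov_two_swap β u v, cov_two_swap β u z, cov_two_swap β v z, cov_two_swap β w z, Nat.factorial]
  ring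

theorem wedgeCov_one_three (h : 1 + 3 = 4) (α : Cov 1) (β : Cov 3) (u v w z : E4) :
    wedgeCov h α β ![u, v, w, z] =
      α ![u] * β ![v, w, z] - α ![v] * β ![u, w, z] + α ![w] * β ![u, v, z] -
      α ![z] * β ![u, v, w] := by
  refine (wedgeCov_apply α β ![u, v, w, z]).trans ?_
  have split_args (π : Equiv.Perm (Fin 4)) :
      α (fun i => ![u, v, w, z] (π (Fin.castAdd 3 i))) *
          β (fun j => ![u, v, w, z] (π (Fin.natAdd 1 j))) =
        α ![![u, v, w, z] (π 0)] *
          β ![![u, v, w, z] (π 1), ![u, v, w, z] (π 2), ![u, v, w, z] (π 3)] :=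
    congrArg₂ _ (congrArg α (vec_one_eta _)) (congrArg β (vec_three_eta _))
  simp only [split_args]
  refine (congrArg _ (sum_perm_fin_four fun s i j k l => s •
    (α ![![u, v, w, z] i] * β ![![u, v, w, z] j, ![u, v, w, z] k, ![u, v, w, z] l]))).trans ?_
  simp [cov_three_perm β v w z, cov_three_perm β u w z, cov_three_perm β u v z,
    cov_three_perm β u v w, Nat.factorial]
  ring

/-! ### Linearity and smoothness of the wedge product -/

instance (p : ℕ) : FiniteDimensional ℝ (Cov p) := by
  let f : Cov p →ₗ[ℝ] MultilinearMap ℝ (fun _ : Fin p => E4) ℂ :=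
    { toFun := fun α => α.toMultilinearMap
      map_add' := fun _ _ => rfl
      map_smul' := fun _ _ => rfl }
  refine FiniteDimensional.of_injective f fun α β h => ?_
  ext v
  exact congrArg (fun g : MultilinearMap ℝ (fun _ : Fin p => E4) ℂ => g v) h

section Bilinear

variable {p q n : ℕ} (h : p + q = n)

theorem wedgeCov_smul_left (c : ℂ) (α : Cov p) (β : Cov q) :
    wedgeCov h (c • α) β = c • wedgeCov h α β := by
  subst h
  ext v
  simp only [wedgeCov_apply, ContinuousAlternatingMap.smul_apply, smul_mul_assoc,
    smul_comm _ c, ← Finset.smul_sum]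

theorem wedgeCov_smul_right (c : ℂ) (α : Cov p) (β : Cov q) :
    wedgeCov h α (c • β) = c • wedgeCov h α β := by
  subst h
  ext v
  simp only [wedgeCov_apply, ContinuousAlternatingMap.smul_apply, mul_smul_comm,
    smul_comm _ c, ← Finset.smul_sum]

/-- The wedge product as a continuous bilinear map. -/
def wedgeL : Cov p →L[ℝ] Cov q →L[ℝ] Cov n :=
  (LinearMap.mk₂ ℝ (wedgeCov h)
    (fun α α' β => by
      subst h
      ext v
      simp only [wedgeCov_apply, ContinuousAlternatingMap.add_apply, add_mul, smul_add,
        Finset.sum_add_distrib])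
    (fun c α β => by
      subst h
      ext v
      simp only [wedgeCov_apply, ContinuousAlternatingMap.smul_apply, smul_mul_assoc,
        smul_comm _ c, ← Finset.smul_sum])
    (fun α β β' => by
      subst h
      ext v
      simp only [wedgeCov_apply, ContinuousAlternatingMap.add_apply, mul_add, smul_add,
        Finset.sum_add_distrib])
    (fun c α β => by
      subst h
      ext v
      simp only [wedgeCov_apply, ContinuousAlternatingMap.smul_apply, mul_smul_comm,
        smul_comm _ c, ← Finset.smul_sum])).toContinuousBilinearMap

theorem wedgeCov_add_left (α α' : Cov p) (β : Cov q) :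
    wedgeCov h (α + α') β = wedgeCov h α β + wedgeCov h α' β :=
  (wedgeL h).map_add₂ α α' β

theorem wedgeCov_add_right (α : Cov p) (β β' : Cov q) :
    wedgeCov h α (β + β') = wedgeCov h α β + wedgeCov h α β' :=
  (wedgeL h α).map_add β β'

theorem wedgeCov_neg_left (α : Cov p) (β : Cov q) : wedgeCov h (-α) β = -wedgeCov h α β :=
  (wedgeL h).map_neg₂ α β

theorem wedgeCov_neg_right (α : Cov p) (β : Cov q) : wedgeCov h α (-β) = -wedgeCov h α β :=
  (wedgeL h α).map_neg β

variable {α : Form p} {β : Form q}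

theorem hasFDerivAt_wedge {x : E4} (hα : DifferentiableAt ℝ α x) (hβ : DifferentiableAt ℝ β x) :
    HasFDerivAt (wedge h α β) ((wedgeL h).precompR E4 (α x) (fderiv ℝ β x) +
      (wedgeL h).precompL E4 (fderiv ℝ α x) (β x)) x :=
  (wedgeL h).hasFDerivAt_of_bilinear hα.hasFDerivAt hβ.hasFDerivAt

theorem fderiv_wedge_apply {x : E4} (hα : DifferentiableAt ℝ α x) (hβ : DifferentiableAt ℝ β x)
    (u : E4) : fderiv ℝ (wedge h α β) x u =
      wedgeCov h (α x) (fderiv ℝ β x u) + wedgeCov h (fderiv ℝ α x u) (β x) := by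
  rw [(hasFDerivAt_wedge h hα hβ).fderiv]
  rfl

theorem contDiffOn_wedge {k : WithTop ℕ∞} {s : Set E4} (hα : ContDiffOn ℝ k α s)
    (hβ : ContDiffOn ℝ k β s) : ContDiffOn ℝ k (wedge h α β) s := by
  change ContDiffOn ℝ k (fun x => wedgeL h (α x) (β x)) s
  exact ((wedgeL h).contDiff.comp_contDiffOn hα).clm_apply hβ

end Bilinear

theorem wedgeCov_two_one_comm (h : 2 + 1 = 3) (h' : 1 + 2 = 3) (α : Cov 2) (β : Cov 1) :
    wedgeCov h α β = wedgeCov h' β α := by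
  apply cov_three_ext
  intro u v w
  rw [wedgeCov_two_one, wedgeCov_one_two]
  ring

/-! ### The exterior derivative -/

section ExtDeriv

variable {p : ℕ} {α β : Form p} {x : E4}

theorem extDeriv_fun_sub (hα : DifferentiableAt ℝ α x) (hβ : DifferentiableAt ℝ β x) :
    extDeriv (fun y => α y - β y) x = extDeriv α x - extDeriv β x := by
  rw [extDeriv, fderiv_fun_sub hα hβ]
  exact map_sub (ContinuousAlternatingMap.alternatizeUncurryFinCLM ℝ E4 ℂ (n := p)) _ _

theorem extDeriv_neg (α : Form p) (x : E4) : extDeriv (-α) x = -extDeriv α x := by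
  rw [extDeriv, fderiv_neg]
  exact map_neg (ContinuousAlternatingMap.alternatizeUncurryFinCLM ℝ E4 ℂ (n := p)) _

theorem extDeriv_const_smul (c : ℂ) (hα : DifferentiableAt ℝ α x) :
    extDeriv (fun y => c • α y) x = c • extDeriv α x := by
  ext v
  rw [extDeriv, fderiv_fun_const_smul hα]
  simp only [extDeriv, ContinuousAlternatingMap.alternatizeUncurryFin_apply,
    ContinuousAlternatingMap.smul_apply, _root_.smul_apply, Finset.smul_sum,
    smul_comm _ c]

theorem extDeriv_fun_sum {ι : Type*} (s : Finset ι) {α : ι → Form p}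
    (hα : ∀ i ∈ s, DifferentiableAt ℝ (α i) x) :
    extDeriv (fun y => ∑ i ∈ s, α i y) x = ∑ i ∈ s, extDeriv (α i) x := by
  rw [extDeriv, fderiv_fun_sum hα]
  exact map_sum (ContinuousAlternatingMap.alternatizeUncurryFinCLM ℝ E4 ℂ (n := p)) _ _

theorem extDeriv_extDeriv_eq_zero (hα : ContDiffAt ℝ ∞ α x) : extDeriv (extDeriv α) x = 0 := by
  refine extDeriv_extDeriv_apply hα ?_
  rw [minSmoothness_of_isRCLikeNormedField]
  exact WithTop.coe_le_coe.2 (le_top : (2 : ℕ∞) ≤ ⊤)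

theorem differentiableAt_extDeriv (hα : ContDiffAt ℝ ∞ α x) :
    DifferentiableAt ℝ (extDeriv α) x :=
  (ContinuousAlternatingMap.alternatizeUncurryFinCLM ℝ E4 ℂ).differentiableAt.comp x
    ((hα.fderiv_right (m := ∞) (by simp)).differentiableAt (by simp))

theorem contDiffOn_extDeriv {s : Set E4} (hs : IsOpen s) (hα : ContDiffOn ℝ ∞ α s) :
    ContDiffOn ℝ ∞ (extDeriv α) s :=
  (ContinuousAlternatingMap.alternatizeUncurryFinCLM ℝ E4 ℂ).contDiff.comp_contDiffOn
    (hα.fderiv_of_isOpen hs (by simp))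

end ExtDeriv

theorem alternatizeUncurryFin_one (f : E4 →L[ℝ] Cov 1) (u v : E4) :
    ContinuousAlternatingMap.alternatizeUncurryFin f ![u, v] = f u ![v] - f v ![u] := by
  have remove_one : (1 : Fin 2).removeNth ![u, v] = ![u] := vec_one_eta _
  simp [ContinuousAlternatingMap.alternatizeUncurryFin_apply, Fin.sum_univ_two,
    remove_one, sub_eq_add_neg]

theorem alternatizeUncurryFin_two (f : E4 →L[ℝ] Cov 2) (u v w : E4) :
    ContinuousAlternatingMap.alternatizeUncurryFin f ![u, v, w] =
      f u ![v, w] - f v ![u, w] + f w ![u, v] := by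
  have remove_one : (1 : Fin 3).removeNth ![u, v, w] = ![u, w] := vec_two_eta _
  have remove_two : (2 : Fin 3).removeNth ![u, v, w] = ![u, v] := vec_two_eta _
  simp [ContinuousAlternatingMap.alternatizeUncurryFin_apply, Fin.sum_univ_three,
    remove_one, remove_two, sub_eq_add_neg]

theorem alternatizeUncurryFin_three (f : E4 →L[ℝ] Cov 3) (u v w z : E4) :
    ContinuousAlternatingMap.alternatizeUncurryFin f ![u, v, w, z] =
      f u ![v, w, z] - f v ![u, w, z] + f w ![u, v, z] - f z ![u, v, w] := by
  have remove_one : (1 : Fin 4).removeNth ![u, v, w, z] = ![u, w, z] := vec_three_eta _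
  have remove_two : (2 : Fin 4).removeNth ![u, v, w, z] = ![u, v, z] := vec_three_eta _
  have remove_three : (3 : Fin 4).removeNth ![u, v, w, z] = ![u, v, w] := vec_three_eta _
  simp [ContinuousAlternatingMap.alternatizeUncurryFin_apply, Fin.sum_univ_four,
    remove_one, remove_two, remove_three, sub_eq_add_neg, pow_succ]

theorem extDeriv_wedge_one_one (h : 1 + 1 = 2) {α β : Form 1} {x : E4}
    (hα : DifferentiableAt ℝ α x) (hβ : DifferentiableAt ℝ β x) :
    extDeriv (wedge h α β) x =
      wedgeCov (n := 3) rfl (extDeriv α x) (β x) - wedgeCov (n := 3) rfl (α x) (extDeriv β x) := by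
  apply cov_three_ext
  intro u v w
  simp only [ContinuousAlternatingMap.sub_apply]
  rw [wedgeCov_one_two, wedgeCov_two_one]
  simp only [extDeriv, alternatizeUncurryFin_two, alternatizeUncurryFin_one,
    fderiv_wedge_apply h hα hβ, ContinuousAlternatingMap.add_apply, wedgeCov_one_one]
  ring

theorem extDeriv_wedge_one_two (h : 1 + 2 = 3) {α : Form 1} {β : Form 2} {x : E4}
    (hα : DifferentiableAt ℝ α x) (hβ : DifferentiableAt ℝ β x) :
    extDeriv (wedge h α β) x =
      wedgeCov (n := 4) rfl (extDeriv α x) (β x) - wedgeCov (n := 4) rfl (α x) (extDeriv β x) := by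
  apply cov_four_ext
  intro u v w z
  simp only [ContinuousAlternatingMap.sub_apply]
  rw [wedgeCov_two_two, wedgeCov_one_three]
  simp only [extDeriv, alternatizeUncurryFin_three, alternatizeUncurryFin_two,
    alternatizeUncurryFin_one, fderiv_wedge_apply h hα hβ, ContinuousAlternatingMap.add_apply,
    wedgeCov_one_two]
  ring

/-! ### Spinor-valued forms -/

theorem eps_zero_zero : eps 0 0 = 0 := rfl

theorem eps_zero_one : eps 0 1 = 1 := rfl

theorem eps_one_zero : eps 1 0 = -1 := rfl

theorem eps_one_one : eps 1 1 = 0 := rfl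

section Components

variable {p q n : ℕ}

theorem lower_zero_zero (X : SForm p) : lower X 0 0 = X 1 1 := by
  ext x v
  simp [lower, eps_zero_zero, eps_one_zero]

theorem lower_zero_one (X : SForm p) : lower X 0 1 = -X 1 0 := by
  ext x v
  simp [lower, eps_zero_zero, eps_one_zero, eps_zero_one, eps_one_one]

theorem lower_one_zero (X : SForm p) : lower X 1 0 = -X 0 1 := by
  ext x v
  simp [lower, eps_zero_zero, eps_one_zero, eps_zero_one, eps_one_one]

theorem lower_one_one (X : SForm p) : lower X 1 1 = X 0 0 := by
  ext x v
  simp [lower, eps_zero_one, eps_one_one]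

theorem raiseFirst_zero (X : SForm p) (B : Fin 2) : raiseFirst X 0 B = X 1 B := by
  ext x v
  simp [raiseFirst, eps_zero_zero, eps_zero_one]

theorem raiseFirst_one (X : SForm p) (B : Fin 2) : raiseFirst X 1 B = -X 0 B := by
  ext x v
  simp [raiseFirst, eps_one_zero, eps_one_one]

theorem actLower_eq (Γ : SForm 1) (X : SForm p) (A B : Fin 2) (x : E4) :
    actLower Γ X A B x =
      wedge (Nat.add_comm 1 p) (Γ 0 A) (X 1 B) x - wedge (Nat.add_comm 1 p) (Γ 1 A) (X 0 B) x +
      (wedge (Nat.add_comm 1 p) (Γ 0 B) (X 1 A) x -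
        wedge (Nat.add_comm 1 p) (Γ 1 B) (X 0 A) x) := by
  simp only [actLower, Fin.sum_univ_two, raiseFirst_zero, raiseFirst_one, wedge, Pi.neg_apply,
    wedgeCov_neg_right]
  abel

theorem lower_symm {X : SForm p} (hX : ∀ A B, X A B = X B A) (A B : Fin 2) :
    lower X A B = lower X B A := by
  revert A B
  simp [Fin.forall_fin_two, lower_zero_one, lower_one_zero, hX 1 0]

theorem actLower_lower {Γ : SForm 1} {X : SForm p} (hΓ : ∀ A B, Γ A B = Γ B A)
    (hX : ∀ A B, X A B = X B A) (A B : Fin 2) (x : E4) :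
    actLower Γ (lower X) A B x = lower (actUpper Γ X) A B x := by
  revert A B
  simp only [Fin.forall_fin_two, actLower_eq, lower_zero_zero, lower_zero_one, lower_one_zero,
    lower_one_one, Pi.neg_apply, wedge, wedgeCov_neg_right, actUpper, Fin.sum_univ_two,
    raiseFirst_zero, raiseFirst_one, wedgeCov_neg_left, hΓ 1 0, hX 1 0]
  refine ⟨⟨?_, ?_⟩, ?_, ?_⟩ <;> abel

theorem actLower_add (Γ : SForm 1) (X Y : SForm p) (A B : Fin 2) (x : E4) :
    actLower Γ (fun A B x => X A B x + Y A B x) A B x =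
      actLower Γ X A B x + actLower Γ Y A B x := by
  simp only [actLower_eq, wedge, wedgeCov_add_right]
  abel

theorem differentiableAt_lower {X : SForm p} {x : E4} (hX : ∀ A B, DifferentiableAt ℝ (X A B) x)
    (A B : Fin 2) : DifferentiableAt ℝ (lower X A B) x :=
  DifferentiableAt.fun_sum fun C _ => DifferentiableAt.fun_sum fun D _ => (hX C D).fun_const_smul _

theorem lower_add (X Y : SForm p) :
    lower (fun A B x => X A B x + Y A B x) = fun A B x => lower X A B x + lower Y A B x := by
  ext1 A; ext1 B; ext1 x
  simp only [lower, smul_add, Finset.sum_add_distrib]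

theorem contract_add_left (h : p + q = n) (X X' : SForm p) (Y : SForm q) (x : E4) :
    contract h (fun A B x => X A B x + X' A B x) Y x = contract h X Y x + contract h X' Y x := by
  simp only [contract, wedge, wedgeCov_add_left, Finset.sum_add_distrib]

theorem contract_add_right (h : p + q = n) (X : SForm p) (Y Y' : SForm q) (x : E4) :
    contract h X (fun A B x => Y A B x + Y' A B x) x = contract h X Y x + contract h X Y' x := by
  simp only [contract, wedge, wedgeCov_add_right, Finset.sum_add_distrib]

theorem lower_lower (X : SForm p) : lower (lower X) = X := by
  ext1 A; ext1 B
  revert A B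
  simp only [Fin.forall_fin_two, lower_zero_zero, lower_zero_one, lower_one_zero, lower_one_one,
    neg_neg, and_self]

theorem contract_lower_left (h : p + q = n) (X : SForm p) (Y : SForm q) (x : E4) :
    contract h (lower X) Y x = contract h X (lower Y) x := by
  simp only [contract, Fin.sum_univ_two, wedge, lower_zero_zero, lower_zero_one, lower_one_zero,
    lower_one_one, Pi.neg_apply, wedgeCov_neg_left, wedgeCov_neg_right]
  abel

theorem contract_two_one_comm (X : SForm 2) (Y : SForm 1) (x : E4) :
    contract (n := 3) rfl X Y x = contract (n := 3) rfl Y X x := by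
  simp only [contract, wedge, wedgeCov_two_one_comm rfl rfl]

theorem contract_lower_eq_zero (h : p + q = n) (X : SForm p) {Y : SForm q} {x : E4}
    (hY : ∀ A B, Y A B x = 0) : contract h X (lower Y) x = 0 := by
  have lower_eq_zero (A B) : lower Y A B x = 0 := by
    revert A B
    simp only [Fin.forall_fin_two, lower_zero_zero, lower_zero_one, lower_one_zero, lower_one_one,
      Pi.neg_apply, hY, neg_zero, and_self]
  refine Finset.sum_eq_zero fun A _ => Finset.sum_eq_zero fun B _ => ?_
  rw [wedge, lower_eq_zero]
  exact (wedgeL h (X A B x)).map_zero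

theorem contDiffOn_lower {X : SForm p} {s : Set E4} (hX : ∀ A B, ContDiffOn ℝ ∞ (X A B) s)
    (A B : Fin 2) : ContDiffOn ℝ ∞ (lower X A B) s :=
  ContDiffOn.sum fun C _ => ContDiffOn.sum fun D _ => (hX C D).const_smul _

theorem contDiffOn_contract (h : p + q = n) {X : SForm p} {Y : SForm q} {s : Set E4}
    (hX : ∀ A B, ContDiffOn ℝ ∞ (X A B) s) (hY : ∀ A B, ContDiffOn ℝ ∞ (Y A B) s) :
    ContDiffOn ℝ ∞ (contract h X Y) s :=
  ContDiffOn.sum fun A _ => ContDiffOn.sum fun B _ => contDiffOn_wedge h (hX A B) (hY A B)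

end Components

/-! ### The calculus of the covariant exterior derivative -/

/-- The action `2 F_{C(A} ∧ X^C_{B)}` of a curvature `2`-form on a spinor-valued `1`-form; it is
`actLower` with the connection replaced by its curvature. -/
def curvatureAct (F : SForm 2) (X : SForm 1) : SForm 3 :=
  fun A B x => ∑ C, (wedge (n := 3) rfl (F C A) (raiseFirst X C B) x +
    wedge (n := 3) rfl (F C B) (raiseFirst X C A) x)

theorem curvatureAct_add (F G : SForm 2) (X : SForm 1) (A B : Fin 2) (x : E4) :
    curvatureAct (fun A B x => F A B x + G A B x) X A B x =
      curvatureAct F X A B x + curvatureAct G X A B x := by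
  simp only [curvatureAct, Fin.sum_univ_two, wedge, wedgeCov_add_left]
  abel

theorem curvatureAct_lower {S : SForm 2} {γ : SForm 1} (hS : ∀ A B, S A B = S B A)
    (hγ : ∀ A B, γ A B = γ B A) (A B : Fin 2) (x : E4) :
    curvatureAct (lower S) γ A B x = -lower (actUpper γ S) A B x := by
  revert A B
  simp only [Fin.forall_fin_two, curvatureAct, lower_zero_zero, lower_zero_one, lower_one_zero,
    lower_one_one, Pi.neg_apply, wedge, actUpper, Fin.sum_univ_two, raiseFirst_zero,
    raiseFirst_one, wedgeCov_neg_left, wedgeCov_neg_right, hγ 1 0, hS 1 0,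
    wedgeCov_two_one_comm rfl (Nat.add_comm 1 2)]
  refine ⟨⟨?_, ?_⟩, ?_, ?_⟩ <;> abel

theorem extDeriv_lower {p : ℕ} (X : SForm p) (A B : Fin 2) (x : E4) :
    extDeriv (lower X A B) x = lower (fun A B => extDeriv (X A B)) A B x := by
  revert A B
  simp only [Fin.forall_fin_two, lower_zero_zero, lower_zero_one, lower_one_zero, lower_one_one,
    extDeriv_neg, Pi.neg_apply, and_self]

theorem covDLower_lower {p : ℕ} {Γ : SForm 1} {X : SForm p} (hΓ : ∀ A B, Γ A B = Γ B A)
    (hX : ∀ A B, X A B = X B A) (A B : Fin 2) (x : E4) :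
    covDLower Γ (lower X) A B x = lower (covDUpper Γ X) A B x := by
  simp only [covDLower, extDeriv_lower, actLower_lower hΓ hX]
  simp only [lower, covDUpper, smul_add, Finset.sum_add_distrib]

-- The degrees `1 + 1` and `2 + 1` arising from `actLower` are only definitionally `2` and `3`, so
-- `simp` needs the evaluation lemmas in this form.
theorem wedgeCov_one_one' (h : 1 + 1 = 1 + 1) (α β : Cov 1) (u v : E4) :
    wedgeCov h α β ![u, v] = α ![u] * β ![v] - α ![v] * β ![u] :=
  wedgeCov_one_one h α β u v

theorem wedgeCov_one_two' (h : 1 + 2 = 2 + 1) (α : Cov 1) (β : Cov 2) (u v w : E4) :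
    wedgeCov h α β ![u, v, w] =
      α ![u] * β ![v, w] - α ![v] * β ![u, w] + α ![w] * β ![u, v] :=
  wedgeCov_one_two h α β u v w

section Leibniz

variable {p : ℕ} {Γ : SForm 1} {X : SForm p} {x : E4}

theorem differentiableAt_actLower (hΓ : ∀ A B, DifferentiableAt ℝ (Γ A B) x)
    (hX : ∀ A B, DifferentiableAt ℝ (X A B) x) (A B : Fin 2) :
    DifferentiableAt ℝ (actLower Γ X A B) x := by
  have differentiable (A B C D) :
      DifferentiableAt ℝ (wedge (Nat.add_comm 1 p) (Γ A B) (X C D)) x :=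
    (hasFDerivAt_wedge _ (hΓ A B) (hX C D)).differentiableAt
  rw [show actLower Γ X A B = _ from funext (actLower_eq Γ X A B)]
  exact ((differentiable _ _ _ _).fun_sub (differentiable _ _ _ _)).fun_add
    ((differentiable _ _ _ _).fun_sub (differentiable _ _ _ _))

variable {X : SForm 1}

theorem extDeriv_actLower (hΓ : ∀ A B, DifferentiableAt ℝ (Γ A B) x)
    (hX : ∀ A B, DifferentiableAt ℝ (X A B) x) (A B : Fin 2) :
    extDeriv (actLower Γ X A B) x =
      curvatureAct (fun A B => extDeriv (Γ A B)) X A B x -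
        actLower Γ (fun A B => extDeriv (X A B)) A B x := by
  have differentiable (A B C D) : DifferentiableAt ℝ (wedge (n := 2) rfl (Γ A B) (X C D)) x :=
    (hasFDerivAt_wedge rfl (hΓ A B) (hX C D)).differentiableAt
  have expand : actLower Γ X A B = fun y =>
      (wedge rfl (Γ 0 A) (X 1 B) y - wedge rfl (Γ 1 A) (X 0 B) y) +
        (wedge rfl (Γ 0 B) (X 1 A) y - wedge rfl (Γ 1 B) (X 0 A) y) :=
    funext fun y => actLower_eq Γ X A B y
  rw [expand, extDeriv_fun_add ((differentiable _ _ _ _).fun_sub (differentiable _ _ _ _))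
      ((differentiable _ _ _ _).fun_sub (differentiable _ _ _ _)),
    extDeriv_fun_sub (differentiable _ _ _ _) (differentiable _ _ _ _),
    extDeriv_fun_sub (differentiable _ _ _ _) (differentiable _ _ _ _), actLower_eq]
  simp only [extDeriv_wedge_one_one rfl (hΓ _ _) (hX _ _), curvatureAct, Fin.sum_univ_two,
    raiseFirst_zero, raiseFirst_one, wedge, Pi.neg_apply, wedgeCov_neg_right]
  abel

theorem actLower_actLower (hΓ : ∀ A B, Γ A B = Γ B A) (hX : ∀ A B, X A B = X B A)
    (A B : Fin 2) (x : E4) :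
    actLower Γ (actLower Γ X) A B x =
      curvatureAct (fun A B x => ∑ C, wedge rfl (Γ C A) (raiseFirst Γ C B) x) X A B x := by
  apply cov_three_ext
  intro u v w
  simp only [actLower_eq, curvatureAct, wedge, Fin.sum_univ_two,
    raiseFirst_zero, raiseFirst_one, Pi.neg_apply, wedgeCov_neg_right, ← sub_eq_add_neg]
  simp only [ContinuousAlternatingMap.add_apply, ContinuousAlternatingMap.sub_apply,
    ContinuousAlternatingMap.neg_apply, wedgeCov_one_two', wedgeCov_two_one,
    wedgeCov_one_one']
  revert A B
  simp only [Fin.forall_fin_two, hΓ 1 0, hX 1 0]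
  refine ⟨⟨?_, ?_⟩, ?_, ?_⟩ <;> ring

/-- The Ricci identity. -/
theorem covDLower_covDLower (hΓ : ∀ A B, Γ A B = Γ B A) (hX : ∀ A B, X A B = X B A)
    (hΓ' : ∀ A B, DifferentiableAt ℝ (Γ A B) x) (hX' : ∀ A B, ContDiffAt ℝ ∞ (X A B) x)
    (A B : Fin 2) :
    covDLower Γ (covDLower Γ X) A B x = curvatureAct (curvature Γ) X A B x := by
  have dX (A B) : DifferentiableAt ℝ (X A B) x := (hX' A B).differentiableAt (by simp)
  have ddX : DifferentiableAt ℝ (extDeriv (X A B)) x := differentiableAt_extDeriv (hX' A B)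
  have dΓX := differentiableAt_actLower hΓ' dX A B
  calc covDLower Γ (covDLower Γ X) A B x
      = extDeriv (actLower Γ X A B) x + (actLower Γ (fun A B => extDeriv (X A B)) A B x +
          actLower Γ (actLower Γ X) A B x) := by
        rw [← actLower_add]
        change extDeriv (fun y => extDeriv (X A B) y + actLower Γ X A B y) x + _ = _
        rw [extDeriv_fun_add ddX dΓX, extDeriv_extDeriv_eq_zero (hX' A B), zero_add]
        rfl
    _ = curvatureAct (curvature Γ) X A B x := by
        rw [extDeriv_actLower hΓ' dX, actLower_actLower hΓ hX, ← add_assoc, sub_add_cancel,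
          ← curvatureAct_add]
        rfl

theorem contract_actLower_one_one {Y : SForm 1} (hΓ : ∀ A B, Γ A B = Γ B A)
    (hX : ∀ A B, X A B = X B A) (hY : ∀ A B, Y A B = Y B A) (x : E4) :
    contract (n := 3) rfl (actLower Γ X) (lower Y) x =
      contract (n := 3) rfl X (lower (actLower Γ Y)) x := by
  apply cov_three_ext
  intro u v w
  simp only [contract, Fin.sum_univ_two, lower_zero_zero, lower_zero_one, lower_one_zero,
    lower_one_one, actLower_eq, wedge, Pi.neg_apply, wedgeCov_neg_right,
    ContinuousAlternatingMap.add_apply, ContinuousAlternatingMap.sub_apply,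
    ContinuousAlternatingMap.neg_apply, wedgeCov_one_two, wedgeCov_two_one, wedgeCov_one_one',
    hΓ 1 0, hX 1 0, hY 1 0]
  ring

theorem contract_actLower_one_two {Y : SForm 2} (hΓ : ∀ A B, Γ A B = Γ B A)
    (hX : ∀ A B, X A B = X B A) (hY : ∀ A B, Y A B = Y B A) (x : E4) :
    contract (n := 4) rfl (actLower Γ X) (lower Y) x =
      contract (n := 4) rfl X (lower (actLower Γ Y)) x := by
  apply cov_four_ext
  intro u v w z
  simp only [contract, Fin.sum_univ_two, lower_zero_zero, lower_zero_one, lower_one_zero,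
    lower_one_one, actLower_eq, wedge, Pi.neg_apply, wedgeCov_neg_right,
    ContinuousAlternatingMap.add_apply, ContinuousAlternatingMap.sub_apply,
    ContinuousAlternatingMap.neg_apply, wedgeCov_one_three, wedgeCov_two_two, wedgeCov_one_one',
    wedgeCov_one_two', hΓ 1 0, hX 1 0, hY 1 0]
  ring

theorem extDeriv_contract_one_one {Y : SForm 1} (hX : ∀ A B, DifferentiableAt ℝ (X A B) x)
    (hY : ∀ A B, DifferentiableAt ℝ (Y A B) x) :
    extDeriv (contract (n := 2) rfl X Y) x =
      contract (n := 3) rfl (fun A B => extDeriv (X A B)) Y x -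
        contract (n := 3) rfl X (fun A B => extDeriv (Y A B)) x := by
  have dw (A B) : DifferentiableAt ℝ (wedge (n := 2) rfl (X A B) (Y A B)) x :=
    (hasFDerivAt_wedge rfl (hX A B) (hY A B)).differentiableAt
  have sum_wedge (A) : extDeriv (fun y => ∑ B, wedge (n := 2) rfl (X A B) (Y A B) y) x =
      ∑ B, (wedgeCov (n := 3) rfl (extDeriv (X A B) x) (Y A B x) -
        wedgeCov (n := 3) rfl (X A B x) (extDeriv (Y A B) x)) :=
    (extDeriv_fun_sum _ fun B _ => dw A B).trans
      (Finset.sum_congr rfl fun B _ => extDeriv_wedge_one_one rfl (hX A B) (hY A B))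
  unfold contract
  rw [extDeriv_fun_sum _ fun A _ => DifferentiableAt.fun_sum fun B _ => dw A B]
  refine (Finset.sum_congr rfl fun A _ => sum_wedge A).trans ?_
  simp only [Finset.sum_sub_distrib, wedge]

theorem extDeriv_contract_one_two {Y : SForm 2} (hX : ∀ A B, DifferentiableAt ℝ (X A B) x)
    (hY : ∀ A B, DifferentiableAt ℝ (Y A B) x) :
    extDeriv (contract (n := 3) rfl X Y) x =
      contract (n := 4) rfl (fun A B => extDeriv (X A B)) Y x -
        contract (n := 4) rfl X (fun A B => extDeriv (Y A B)) x := by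
  have dw (A B) : DifferentiableAt ℝ (wedge (n := 3) rfl (X A B) (Y A B)) x :=
    (hasFDerivAt_wedge rfl (hX A B) (hY A B)).differentiableAt
  have sum_wedge (A) : extDeriv (fun y => ∑ B, wedge (n := 3) rfl (X A B) (Y A B) y) x =
      ∑ B, (wedgeCov (n := 4) rfl (extDeriv (X A B) x) (Y A B x) -
        wedgeCov (n := 4) rfl (X A B x) (extDeriv (Y A B) x)) :=
    (extDeriv_fun_sum _ fun B _ => dw A B).trans
      (Finset.sum_congr rfl fun B _ => extDeriv_wedge_one_two rfl (hX A B) (hY A B))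
  unfold contract
  rw [extDeriv_fun_sum _ fun A _ => DifferentiableAt.fun_sum fun B _ => dw A B]
  refine (Finset.sum_congr rfl fun A _ => sum_wedge A).trans ?_
  simp only [Finset.sum_sub_distrib, wedge]

theorem extDeriv_contract_lower_one_one {Y : SForm 1} (hΓ : ∀ A B, Γ A B = Γ B A)
    (hX : ∀ A B, X A B = X B A) (hY : ∀ A B, Y A B = Y B A)
    (hX' : ∀ A B, DifferentiableAt ℝ (X A B) x) (hY' : ∀ A B, DifferentiableAt ℝ (Y A B) x) :
    extDeriv (contract (n := 2) rfl X (lower Y)) x =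
      contract (n := 3) rfl (covDLower Γ X) (lower Y) x -
        contract (n := 3) rfl X (lower (covDLower Γ Y)) x := by
  have lower_covDLower : lower (covDLower Γ Y) = fun A B x =>
      extDeriv (lower Y A B) x + lower (actLower Γ Y) A B x := by
    simp only [extDeriv_lower]
    exact lower_add _ _
  rw [extDeriv_contract_one_one hX' (differentiableAt_lower hY'), lower_covDLower]
  refine Eq.trans ?_ (congrArg₂ (· - ·) (contract_add_left _ _ (actLower Γ X) _ x).symm
    (contract_add_right _ X _ (lower (actLower Γ Y)) x).symm)
  rw [contract_actLower_one_one hΓ hX hY]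
  abel

theorem extDeriv_contract_lower_one_two {Y : SForm 2} (hΓ : ∀ A B, Γ A B = Γ B A)
    (hX : ∀ A B, X A B = X B A) (hY : ∀ A B, Y A B = Y B A)
    (hX' : ∀ A B, DifferentiableAt ℝ (X A B) x) (hY' : ∀ A B, DifferentiableAt ℝ (Y A B) x) :
    extDeriv (contract (n := 3) rfl X (lower Y)) x =
      contract (n := 4) rfl (covDLower Γ X) (lower Y) x -
        contract (n := 4) rfl X (lower (covDLower Γ Y)) x := by
  have lower_covDLower : lower (covDLower Γ Y) = fun A B x =>
      extDeriv (lower Y A B) x + lower (actLower Γ Y) A B x := by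
    simp only [extDeriv_lower]
    exact lower_add _ _
  rw [extDeriv_contract_one_two hX' (differentiableAt_lower hY'), lower_covDLower]
  refine Eq.trans ?_ (congrArg₂ (· - ·) (contract_add_left _ _ (actLower Γ X) _ x).symm
    (contract_add_right _ X _ (lower (actLower Γ Y)) x).symm)
  rw [contract_actLower_one_two hΓ hX hY]
  abel

end Leibniz

/-! ### The Weyl spinor and the simplicity constraints -/

/-- A totally symmetric array of four spinor indices. -/
def IsSymmSpinor (φ : (Fin 4 → Fin 2) → ℂ) : Prop :=
  ∀ (π : Equiv.Perm (Fin 4)) (I : Fin 4 → Fin 2), φ (I ∘ π) = φ I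

namespace IsSymmSpinor

variable {φ : (Fin 4 → Fin 2) → ℂ}

theorem swap_first (h : IsSymmSpinor φ) (a b c d : Fin 2) :
    φ ![b, a, c, d] = φ ![a, b, c, d] := by
  rw [← h (Equiv.swap 0 1) ![a, b, c, d]]
  congr 1; ext i : 1; fin_cases i <;> rfl

theorem swap_middle (h : IsSymmSpinor φ) (a b c d : Fin 2) :
    φ ![a, c, b, d] = φ ![a, b, c, d] := by
  rw [← h (Equiv.swap 1 2) ![a, b, c, d]]
  congr 1; ext i : 1; fin_cases i <;> rfl

theorem swap_last (h : IsSymmSpinor φ) (a b c d : Fin 2) :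
    φ ![a, b, d, c] = φ ![a, b, c, d] := by
  rw [← h (Equiv.swap 2 3) ![a, b, c, d]]
  congr 1; ext i : 1; fin_cases i <;> rfl

end IsSymmSpinor

theorem sum_fin_succ_fun {n : ℕ} (f : (Fin (n + 1) → Fin 2) → ℂ) :
    ∑ I, f I = ∑ a, ∑ I : Fin n → Fin 2, f (Matrix.vecCons a I) := by
  rw [← (Fin.consEquiv fun _ : Fin (n + 1) => Fin 2).sum_comp, Fintype.sum_prod_type]
  rfl

theorem sum_fin_four_fun (f : (Fin 4 → Fin 2) → ℂ) :
    ∑ I, f I = ∑ a, ∑ b, ∑ c, ∑ d, f ![a, b, c, d] := by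
  simp only [sum_fin_succ_fun, Fintype.sum_unique]
  rfl

theorem contract4_eq {φ χ : (Fin 4 → Fin 2) → ℂ} (hφ : IsSymmSpinor φ) (hχ : IsSymmSpinor χ) :
    contract4 φ χ = φ ![0, 0, 0, 0] * χ ![1, 1, 1, 1] + φ ![1, 1, 1, 1] * χ ![0, 0, 0, 0] -
      4 * (φ ![0, 0, 0, 1] * χ ![0, 1, 1, 1] + φ ![0, 1, 1, 1] * χ ![0, 0, 0, 1]) +
      6 * (φ ![0, 0, 1, 1] * χ ![0, 0, 1, 1]) := by
  simp only [contract4, sum_fin_four_fun, Fin.prod_univ_four, Fin.sum_univ_two,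
    Matrix.cons_val]
  simp only [eps_zero_zero, eps_zero_one, eps_one_zero, eps_one_one, zero_mul, mul_zero,
    add_zero, zero_add, one_mul, mul_one, hφ.swap_first 0 1, hφ.swap_middle _ 0 1,
    hφ.swap_last _ _ 0 1, hχ.swap_first 0 1, hχ.swap_middle _ 0 1, hχ.swap_last _ _ 0 1]
  ring

/-- The coefficient of the wedge product of two `2`-covectors, as a bilinear form. -/
def pair (α β : Cov 2) : ℂ := topCoeff (wedgeCov rfl α β)

theorem stdB_eq : stdB = ![stdB 0, stdB 1, stdB 2, stdB 3] := vec_four_eta _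

theorem topCoeff_eq (μ : Cov 4) : topCoeff μ = μ ![stdB 0, stdB 1, stdB 2, stdB 3] :=
  congrArg μ stdB_eq

theorem topCoeff_add (μ ν : Cov 4) : topCoeff (μ + ν) = topCoeff μ + topCoeff ν := rfl

theorem topCoeff_smul (c : ℂ) (μ : Cov 4) : topCoeff (c • μ) = c * topCoeff μ := rfl

theorem pair_comm (α β : Cov 2) : pair α β = pair β α := by
  simp only [pair, topCoeff_eq, wedgeCov_two_two]
  ring

theorem pair_add_left (α α' β : Cov 2) : pair (α + α') β = pair α β + pair α' β := by
  rw [pair, wedgeCov_add_left, topCoeff_add, pair, pair]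

theorem pair_add_right (α β β' : Cov 2) : pair α (β + β') = pair α β + pair α β' := by
  rw [pair, wedgeCov_add_right, topCoeff_add, pair, pair]

theorem pair_smul_left (c : ℂ) (α β : Cov 2) : pair (c • α) β = c * pair α β := by
  rw [pair, wedgeCov_smul_left, topCoeff_smul, pair]

theorem pair_smul_right (c : ℂ) (α β : Cov 2) : pair α (c • β) = c * pair α β := by
  rw [pair, wedgeCov_smul_right, topCoeff_smul, pair]

theorem pair_neg_left (α β : Cov 2) : pair (-α) β = -pair α β := by
  rw [← neg_one_smul ℂ α, pair_smul_left, neg_one_mul]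

theorem pair_neg_right (α β : Cov 2) : pair α (-β) = -pair α β := by
  rw [pair_comm, pair_neg_left, pair_comm]

section Simplicity

variable {X Y σ S : SForm 2} {φ ψ : Spinor4} {x : E4}

theorem topCoeff_contract_lower (hX : ∀ A B, X A B x = X B A x)
    (hY : ∀ A B, Y A B x = Y B A x) :
    topCoeff (contract (n := 4) rfl X (lower Y) x) =
      pair (X 0 0 x) (Y 1 1 x) - 2 * pair (X 0 1 x) (Y 0 1 x) + pair (X 1 1 x) (Y 0 0 x) := by
  simp only [contract, wedge, Fin.sum_univ_two, lower_zero_zero, lower_zero_one, lower_one_zero,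
    lower_one_one, Pi.neg_apply, hX 1 0, hY 1 0, topCoeff_add]
  change pair _ _ + pair _ _ + (pair _ _ + pair _ _) = _
  rw [pair_neg_right]
  ring

theorem pair_of_symWedge_eq_zero (hX : ∀ A B, X A B x = X B A x)
    (hY : ∀ A B, Y A B x = Y B A x) (h : ∀ I, symWedge X Y I x = 0) :
    pair (X 0 0 x) (Y 0 0 x) = 0 ∧
    pair (X 0 0 x) (Y 0 1 x) + pair (X 0 1 x) (Y 0 0 x) = 0 ∧
    pair (X 0 0 x) (Y 1 1 x) + 4 * pair (X 0 1 x) (Y 0 1 x) + pair (X 1 1 x) (Y 0 0 x) = 0 ∧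
    pair (X 0 1 x) (Y 1 1 x) + pair (X 1 1 x) (Y 0 1 x) = 0 ∧
    pair (X 1 1 x) (Y 1 1 x) = 0 := by
  have sum_pair (I : Fin 4 → Fin 2) := (sum_perm_fin_four fun _ i j k l =>
    pair (X (I i) (I j) x) (Y (I k) (I l) x)).symm.trans
      (show _ = (0 : ℂ) from by
        have := congrArg topCoeff (h I)
        simp only [symWedge, topCoeff, ContinuousAlternatingMap.sum_apply] at this
        exact this)
  have pair_0000 := sum_pair ![0, 0, 0, 0]
  have pair_0001 := sum_pair ![0, 0, 0, 1]
  have pair_0011 := sum_pair ![0, 0, 1, 1]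
  have pair_0111 := sum_pair ![0, 1, 1, 1]
  have pair_1111 := sum_pair ![1, 1, 1, 1]
  simp only [Matrix.cons_val, hX 1 0, hY 1 0] at pair_0000 pair_0001 pair_0011 pair_0111 pair_1111
  refine ⟨?_, ?_, ?_, ?_, ?_⟩
  · linear_combination pair_0000 / 24
  · linear_combination pair_0001 / 12
  · linear_combination pair_0011 / 4
  · linear_combination pair_0111 / 12
  · linear_combination pair_1111 / 24

theorem pair_of_symWedge_self_eq_zero (hS : ∀ A B, S A B x = S B A x)
    (h : ∀ I, symWedge S S I x = 0) :
    pair (S 0 0 x) (S 0 0 x) = 0 ∧ pair (S 0 0 x) (S 0 1 x) = 0 ∧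
    pair (S 0 0 x) (S 1 1 x) = -2 * pair (S 0 1 x) (S 0 1 x) ∧
    pair (S 0 1 x) (S 1 1 x) = 0 ∧ pair (S 1 1 x) (S 1 1 x) = 0 := by
  obtain ⟨pair_0000, pair_0001, pair_0011, pair_0111, pair_1111⟩ := pair_of_symWedge_eq_zero hS hS h
  refine ⟨pair_0000, ?_, ?_, ?_, pair_1111⟩
  · linear_combination pair_0001 / 2 + pair_comm (S 0 0 x) (S 0 1 x) / 2
  · linear_combination pair_0011 / 2 + pair_comm (S 0 0 x) (S 1 1 x) / 2
  · linear_combination pair_0111 / 2 + pair_comm (S 0 1 x) (S 1 1 x) / 2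

theorem topCoeff_volForm (hS : ∀ A B, S A B x = S B A x) (h : ∀ I, symWedge S S I x = 0) :
    topCoeff (volForm S x) = -pair (S 0 1 x) (S 0 1 x) := by
  obtain ⟨-, -, pair_02, -, -⟩ := pair_of_symWedge_self_eq_zero hS h
  rw [volForm, topCoeff_smul, topCoeff_contract_lower hS hS, pair_comm (S 1 1 x), pair_02]
  ring

theorem weylForm_eq (ψ : Spinor4) (S : SForm 2) (A B : Fin 2) (x : E4) :
    weylForm ψ S A B x = ψ x ![A, B, 0, 0] • S 0 0 x + ψ x ![A, B, 0, 1] • S 0 1 x +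
      (ψ x ![A, B, 1, 0] • S 1 0 x + ψ x ![A, B, 1, 1] • S 1 1 x) := by
  simp only [weylForm, Fin.sum_univ_two]

theorem weylForm_symm (hψ : ∀ x, IsSymmSpinor (ψ x)) (S : SForm 2) (A B : Fin 2) :
    weylForm ψ S A B = weylForm ψ S B A := by
  ext1 x
  simp only [weylForm_eq, (hψ x).swap_first A B]

theorem topCoeff_contract_lower_weylForm (hψ : ∀ x, IsSymmSpinor (ψ x))
    (hσ : ∀ A B, σ A B = σ B A) (hS : ∀ A B, S A B = S B A) (h : ∀ I, symWedge σ S I x = 0) :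
    topCoeff (contract (n := 4) rfl (lower σ) (lower (weylForm ψ S)) x) = 0 := by
  obtain ⟨pair_0000, pair_0001, pair_0011, pair_0111, pair_1111⟩ :=
    pair_of_symWedge_eq_zero (fun A B => congrFun (hσ A B) x) (fun A B => congrFun (hS A B) x) h
  rw [topCoeff_contract_lower (fun A B => congrFun (lower_symm hσ A B) x)
    (fun A B => congrFun (weylForm_symm hψ S A B) x)]
  simp only [lower_zero_zero, lower_zero_one, lower_one_one, Pi.neg_apply, pair_neg_left,
    weylForm_eq, hS 1 0, hσ 1 0, pair_add_right, pair_smul_right, (hψ x).swap_first 0 1,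
    (hψ x).swap_middle _ 0 1, (hψ x).swap_last _ _ 0 1]
  linear_combination ψ x ![0, 0, 0, 0] * pair_0000 + 2 * ψ x ![0, 0, 0, 1] * pair_0001 +
    ψ x ![0, 0, 1, 1] * pair_0011 + 2 * ψ x ![0, 1, 1, 1] * pair_0111 +
    ψ x ![1, 1, 1, 1] * pair_1111

theorem topCoeff_contract_weylForm_weylForm (hφ : ∀ x, IsSymmSpinor (φ x))
    (hψ : ∀ x, IsSymmSpinor (ψ x)) (hS : ∀ A B, S A B = S B A)
    (h : ∀ I, symWedge S S I x = 0) :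
    topCoeff (contract (n := 4) rfl (weylForm φ S) (lower (weylForm ψ S)) x) =
      2 * (contract4 (φ x) (ψ x) * topCoeff (volForm S x)) := by
  have symm_S (A B) : S A B x = S B A x := congrFun (hS A B) x
  obtain ⟨pair_00, pair_01, pair_02, pair_12, pair_22⟩ := pair_of_symWedge_self_eq_zero symm_S h
  rw [topCoeff_volForm symm_S h, contract4_eq (hφ x) (hψ x),
    topCoeff_contract_lower (fun A B => congrFun (weylForm_symm hφ S A B) x)
      (fun A B => congrFun (weylForm_symm hψ S A B) x)]
  simp only [weylForm_eq, hS 1 0, pair_add_right, pair_smul_right, pair_add_left, pair_smul_left,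
    pair_comm (S 0 1 x) (S 0 0 x), pair_comm (S 1 1 x) (S 0 0 x), pair_comm (S 1 1 x) (S 0 1 x),
    pair_00, pair_01, pair_02, pair_12, pair_22, (hφ x).swap_first 0 1,
    (hφ x).swap_middle _ 0 1, (hφ x).swap_last _ _ 0 1, (hψ x).swap_first 0 1,
    (hψ x).swap_middle _ 0 1, (hψ x).swap_last _ _ 0 1]
  ring

end Simplicity

/-! ### The conserved currents of a pair of states -/

theorem isOpen_M : IsOpen M :=
  (isOpen_lt continuous_const continuous_norm).inter (isOpen_lt continuous_norm continuous_const)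

theorem differentiableAt_of_contDiffOn_M {F : Type*} [NormedAddCommGroup F] [NormedSpace ℝ F]
    {f : E4 → F} (hf : ContDiffOn ℝ ∞ f M) {x : E4} (hx : x ∈ M) : DifferentiableAt ℝ f x :=
  (hf.contDiffAt (isOpen_M.mem_nhds hx)).differentiableAt (by simp)

/-- The current `γ_{AB} ∧ ψ'^{AB}{}_{CD} Σ^{CD}` built from the connection of `h` and the
linearised Weyl curvature of `h'`. -/
def current (S : SForm 2) (h h' : Perturbation) : Form 3 :=
  contract rfl h.γ (lower (weylForm h'.ψ S))

/-- The symplectic current `σ^{AB} ∧ γ'_{AB} - σ'^{AB} ∧ γ_{AB}`. -/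
def symplecticCurrent (h h' : Perturbation) : Form 3 :=
  fun x => contract (n := 3) rfl h.σ h'.γ x - contract (n := 3) rfl h'.σ h.γ x

section Currents

variable {Λ : ℝ} {S : SForm 2} {Γ : SForm 1} {Ω : E4 → ℝ} {h h' : Perturbation}

theorem contDiffOn_weylForm {ψ : Spinor4} {s : Set E4} (hψ : ContDiffOn ℝ ∞ ψ s)
    (hS : ∀ A B, ContDiffOn ℝ ∞ (S A B) s) (A B : Fin 2) :
    ContDiffOn ℝ ∞ (weylForm ψ S A B) s :=
  ContDiffOn.sum fun C _ => ContDiffOn.sum fun D _ =>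
    (contDiffOn_pi.1 hψ ![A, B, C, D]).smul (hS C D)

theorem contDiffOn_current (hbg : IsSelfDualBackground Λ S Γ) (hh : IsScatteringState Λ S Γ Ω h)
    (hh' : IsScatteringState Λ S Γ Ω h') : ContDiffOn ℝ ∞ (current S h h') M :=
  contDiffOn_contract _ hh.smooth_γ
    (contDiffOn_lower (contDiffOn_weylForm hh'.smooth_ψ hbg.smooth_S))

theorem contDiffOn_symplecticCurrent (hh : IsScatteringState Λ S Γ Ω h)
    (hh' : IsScatteringState Λ S Γ Ω h') : ContDiffOn ℝ ∞ (symplecticCurrent h h') M :=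
  (contDiffOn_contract _ hh.smooth_σ hh'.smooth_γ).sub
    (contDiffOn_contract _ hh'.smooth_σ hh.smooth_γ)

/-- The linearised Bianchi identity `D (ψ_{ABCD} Σ^{CD}) = 0`. Applying `D` to the linearised
curvature equation, the Ricci identity turns `D² γ` into `(Λ/3) Σ · γ`, which is cancelled by the
linearised torsion equation. -/
theorem covDLower_weylForm (hbg : IsSelfDualBackground Λ S Γ) (hh : IsScatteringState Λ S Γ Ω h)
    {x : E4} (hx : x ∈ M) (A B : Fin 2) : covDLower Γ (weylForm h.ψ S) A B x = 0 := by
  have dΓ (A B) : DifferentiableAt ℝ (Γ A B) x :=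
    differentiableAt_of_contDiffOn_M (hbg.smooth_Γ A B) hx
  have cγ (A B) : ContDiffAt ℝ ∞ (h.γ A B) x :=
    (hh.smooth_γ A B).contDiffAt (isOpen_M.mem_nhds hx)
  have dσ : DifferentiableAt ℝ (lower h.σ A B) x :=
    differentiableAt_of_contDiffOn_M (contDiffOn_lower hh.smooth_σ A B) hx
  have dDγ : DifferentiableAt ℝ (covDLower Γ h.γ A B) x :=
    (differentiableAt_extDeriv (cγ A B)).add
      (differentiableAt_actLower dΓ (fun A B => (cγ A B).differentiableAt (by simp)) A B)
  set c : ℂ := ((Λ / 3 : ℝ) : ℂ) with hc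
  have weyl_eventuallyEq : weylForm h.ψ S A B =ᶠ[𝓝 x]
      fun y => covDLower Γ h.γ A B y - c • lower h.σ A B y :=
    Filter.eventually_of_mem (isOpen_M.mem_nhds hx) fun y hy =>
      eq_sub_of_add_eq (hh.lin_curvature A B y hy).symm
  have act_weyl : actLower Γ (weylForm h.ψ S) A B x =
      actLower Γ (covDLower Γ h.γ) A B x - c • actLower Γ (lower h.σ) A B x := by
    rw [eq_sub_iff_add_eq]
    simp only [actLower_eq, wedge, hh.lin_curvature _ _ x hx, wedgeCov_add_right,
      wedgeCov_smul_right, ← hc]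
    module
  have curvature_act : curvatureAct (curvature Γ) h.γ A B x =
      c • curvatureAct (lower S) h.γ A B x := by
    simp only [curvatureAct, raiseFirst, wedge, hbg.curvature_eq _ _ x hx, wedgeCov_smul_left,
      Finset.smul_sum, smul_add, hc]
  calc covDLower Γ (weylForm h.ψ S) A B x
      = covDLower Γ (covDLower Γ h.γ) A B x - c • covDLower Γ (lower h.σ) A B x := by
        change extDeriv (weylForm h.ψ S A B) x + actLower Γ (weylForm h.ψ S) A B x =
          extDeriv (covDLower Γ h.γ A B) x + actLower Γ (covDLower Γ h.γ) A B x -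
            c • (extDeriv (lower h.σ A B) x + actLower Γ (lower h.σ) A B x)
        rw [weyl_eventuallyEq.extDeriv_eq, extDeriv_fun_sub dDγ (dσ.fun_const_smul _),
          extDeriv_const_smul _ dσ, act_weyl]
        module
    _ = c • curvatureAct (lower S) h.γ A B x - c • lower (covDUpper Γ h.σ) A B x := by
        rw [covDLower_covDLower hbg.symm_Γ hh.symm_γ dΓ cγ, curvature_act,
          covDLower_lower hbg.symm_Γ hh.symm_σ]
    _ = 0 := by
        rw [curvatureAct_lower hbg.symm_S hh.symm_γ]
        simp only [lower, hh.lin_torsion _ _ x hx, smul_neg, Finset.sum_neg_distrib, sub_self]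

theorem topCoeff_extDeriv_current (hbg : IsSelfDualBackground Λ S Γ)
    (hh : IsScatteringState Λ S Γ Ω h) (hh' : IsScatteringState Λ S Γ Ω h') {x : E4} (hx : x ∈ M) :
    topCoeff (extDeriv (current S h h') x) = 2 * cgDensity S h h' x := by
  have dγ (A B) : DifferentiableAt ℝ (h.γ A B) x :=
    differentiableAt_of_contDiffOn_M (hh.smooth_γ A B) hx
  have dΨ (A B) : DifferentiableAt ℝ (weylForm h'.ψ S A B) x :=
    differentiableAt_of_contDiffOn_M (contDiffOn_weylForm hh'.smooth_ψ hbg.smooth_S A B) hx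
  have Dγ : contract (n := 4) rfl (covDLower Γ h.γ) (lower (weylForm h'.ψ S)) x =
      contract (n := 4) rfl (weylForm h.ψ S) (lower (weylForm h'.ψ S)) x +
        ((Λ / 3 : ℝ) : ℂ) • contract (n := 4) rfl (lower h.σ) (lower (weylForm h'.ψ S)) x := by
    simp only [contract, wedge, hh.lin_curvature _ _ x hx, wedgeCov_add_left, wedgeCov_smul_left,
      Finset.sum_add_distrib, Finset.smul_sum]
  have DΨ : contract (n := 4) rfl h.γ (lower (covDLower Γ (weylForm h'.ψ S))) x = 0 :=
    contract_lower_eq_zero rfl h.γ (covDLower_weylForm hbg hh' hx)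
  rw [current, extDeriv_contract_lower_one_two hbg.symm_Γ hh.symm_γ (weylForm_symm hh'.symm_ψ S)
    dγ dΨ, DΨ, sub_zero, Dγ, topCoeff_add, topCoeff_smul,
    topCoeff_contract_weylForm_weylForm hh.symm_ψ hh'.symm_ψ hbg.symm_S
      (fun I => hbg.simplicity I x hx),
    topCoeff_contract_lower_weylForm hh'.symm_ψ hh.symm_σ hbg.symm_S
      (fun I => hh.lin_simplicity I x hx), mul_zero, add_zero, cgDensity]

theorem current_sub_current (hbg : IsSelfDualBackground Λ S Γ)
    (hh : IsScatteringState Λ S Γ Ω h) (hh' : IsScatteringState Λ S Γ Ω h') {x : E4} (hx : x ∈ M) :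
    current S h' h x - current S h h' x =
      extDeriv (contract (n := 2) rfl h.γ (lower h'.γ)) x -
        ((Λ / 3 : ℝ) : ℂ) • symplecticCurrent h h' x := by
  have dγ (A B) : DifferentiableAt ℝ (h.γ A B) x :=
    differentiableAt_of_contDiffOn_M (hh.smooth_γ A B) hx
  have dγ' (A B) : DifferentiableAt ℝ (h'.γ A B) x :=
    differentiableAt_of_contDiffOn_M (hh'.smooth_γ A B) hx
  have Dγ : contract (n := 3) rfl (covDLower Γ h.γ) (lower h'.γ) x =
      current S h' h x + ((Λ / 3 : ℝ) : ℂ) • contract (n := 3) rfl h.σ h'.γ x := by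
    rw [current, ← contract_two_one_comm, contract_lower_left, ← lower_lower h'.γ,
      ← contract_lower_left rfl h.σ, lower_lower h'.γ]
    simp only [contract, wedge, hh.lin_curvature _ _ x hx, wedgeCov_add_left, wedgeCov_smul_left,
      Finset.sum_add_distrib, Finset.smul_sum]
  have Dγ' : contract (n := 3) rfl h.γ (lower (covDLower Γ h'.γ)) x =
      current S h h' x + ((Λ / 3 : ℝ) : ℂ) • contract (n := 3) rfl h'.σ h.γ x := by
    rw [current, contract_two_one_comm, ← contract_lower_left, ← contract_lower_left,
      ← lower_lower h'.σ, ← contract_lower_left]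
    simp only [contract, wedge, hh'.lin_curvature _ _ x hx, wedgeCov_add_right,
      wedgeCov_smul_right, Finset.sum_add_distrib, Finset.smul_sum]
  rw [extDeriv_contract_lower_one_one hbg.symm_Γ hh.symm_γ hh'.symm_γ dγ dγ', Dγ, Dγ',
    symplecticCurrent, smul_sub]
  abel

end Currents

/-! ### Injectivity of the torsion map -/

section Skew

variable {K : Type*} [Field K]

/-- The skew `4 × 4` matrix with entries `p` above the diagonal; it encodes a `2`-covector. -/
def skew (p : Fin 6 → K) : Matrix (Fin 4) (Fin 4) K :=
  !![0, p 0, p 1, p 2; -p 0, 0, p 3, p 4; -p 1, -p 3, 0, p 5; -p 2, -p 4, -p 5, 0]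

/-- The Hodge dual of `skew p`; it is the matrix of `α ↦ α ∧ B` when `p` are the components of the
`2`-covector `B`. -/
def skewDual (p : Fin 6 → K) : Matrix (Fin 4) (Fin 4) K :=
  skew ![p 5, -p 4, p 3, p 2, -p 1, p 0]

/-- Twice the polarised Pfaffian of skew `4 × 4` matrices, which encodes the wedge product of
`2`-covectors. -/
def pfaff (p q : Fin 6 → K) : K :=
  p 0 * q 5 - p 1 * q 4 + p 2 * q 3 + p 3 * q 2 - p 4 * q 1 + p 5 * q 0

theorem skew_mul_skewDual_add (p q : Fin 6 → K) :
    skew p * skewDual q + skew q * skewDual p = -pfaff p q • (1 : Matrix (Fin 4) (Fin 4) K) := by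
  ext i j
  fin_cases i <;> fin_cases j <;>
    simp [skew, skewDual, pfaff] <;> ring

theorem skewDual_mul_skew_add (p q : Fin 6 → K) :
    skewDual p * skew q + skewDual q * skew p = -pfaff p q • (1 : Matrix (Fin 4) (Fin 4) K) := by
  ext i j
  fin_cases i <;> fin_cases j <;>
    simp [skew, skewDual, pfaff] <;> ring

theorem skew_mul_skewDual_self [NeZero (2 : K)] (p : Fin 6 → K) :
    skew p * skewDual p = (-pfaff p p / 2) • (1 : Matrix (Fin 4) (Fin 4) K) := by
  have h := skew_mul_skewDual_add p p
  rw [← two_smul K] at h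
  rw [← inv_smul_smul₀ (two_ne_zero' K) (skew p * _), h, smul_smul, inv_mul_eq_div]

theorem eq_zero_of_sq_eq_zero_of_mulVec_comm {n : Type*} [Fintype n] [DecidableEq n]
    {X Y : Matrix n n K} {c : K} (hc : c ≠ 0) (hX : X * X = 0) (hXY : X * Y + Y * X = c • 1)
    {b : n → K} (hb : X.mulVec (Y.mulVec b) = Y.mulVec (X.mulVec b)) : b = 0 := by
  have anticomm : X.mulVec (Y.mulVec b) + Y.mulVec (X.mulVec b) = c • b := by
    rw [Matrix.mulVec_mulVec, Matrix.mulVec_mulVec, ← Matrix.add_mulVec, hXY, Matrix.smul_mulVec,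
      Matrix.one_mulVec]
  have X_X (v : n → K) : X.mulVec (X.mulVec v) = 0 := by
    rw [Matrix.mulVec_mulVec, hX, Matrix.zero_mulVec]
  have X_b : X.mulVec b = 0 := by
    have h := congrArg X.mulVec anticomm
    rw [← hb, Matrix.mulVec_add, X_X, add_zero, Matrix.mulVec_smul] at h
    exact (smul_eq_zero_iff_right hc).1 h.symm
  rw [hb, X_b, Matrix.mulVec_zero, add_zero] at anticomm
  exact (smul_eq_zero_iff_right hc).1 anticomm.symm

theorem eq_zero_of_skewDual_mulVec [NeZero (2 : K)] {p q r : Fin 6 → K} {a b c : Fin 4 → K}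
    (hpp : pfaff p p = 0) (hpq : pfaff p q = 0) (hrq : pfaff r q = 0)
    (hpr : pfaff p r = -2 * pfaff q q) (hq : pfaff q q ≠ 0)
    (e₁ : (skewDual p).mulVec b + (skewDual q).mulVec c = 0)
    (e₂ : (skewDual q).mulVec a + (skewDual r).mulVec b = 0)
    (e₃ : (skewDual r).mulVec c = (skewDual p).mulVec a) : a = 0 ∧ b = 0 ∧ c = 0 := by
  set k := pfaff q q with hk
  have half_ne : k / 2 ≠ 0 := div_ne_zero hq two_ne_zero
  have S_D {u v : Fin 4 → K} {s : Fin 6 → K}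
      (h : (skewDual s).mulVec u + (skewDual q).mulVec v = 0) :
      (k / 2) • v = (skew q * skewDual s).mulVec u := by
    have h := congrArg (skew q).mulVec h
    rw [Matrix.mulVec_add, Matrix.mulVec_mulVec, Matrix.mulVec_mulVec, skew_mul_skewDual_self, ← hk,
      Matrix.smul_mulVec, Matrix.one_mulVec, Matrix.mulVec_zero, neg_div, neg_smul,
      add_neg_eq_zero] at h
    exact h.symm
  have swap (s t : Fin 6 → K) (hs : pfaff s q = 0) :
      skew q * skewDual s * (skew q * skewDual t) = (k / 2) • (skew s * skewDual t) := by
    have D_S : skewDual s * skew q = -(skewDual q * skew s) :=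
      eq_neg_of_add_eq_zero_left (by rw [skewDual_mul_skew_add, hs, neg_zero, zero_smul])
    rw [Matrix.mul_assoc, ← Matrix.mul_assoc (skewDual s), D_S, Matrix.neg_mul, Matrix.mul_neg,
      Matrix.mul_assoc, ← Matrix.mul_assoc (skew q), skew_mul_skewDual_self, ← hk, Matrix.smul_mul,
      Matrix.one_mul, neg_div, neg_smul, neg_neg]
  have hc : (k / 2) • c = (skew q * skewDual p).mulVec b := S_D e₁
  have ha : (k / 2) • a = (skew q * skewDual r).mulVec b := S_D (by rw [add_comm, e₂])
  have hb : b = 0 := by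
    refine eq_zero_of_sq_eq_zero_of_mulVec_comm (X := skew q * skewDual p)
      (Y := skew q * skewDual r) (c := k / 2 * (2 * k))
      (mul_ne_zero half_ne (mul_ne_zero two_ne_zero hq)) ?_ ?_ ?_
    · rw [swap p p hpq, skew_mul_skewDual_self, hpp, neg_zero, zero_div, zero_smul, smul_zero]
    · rw [swap p r hpq, swap r p hrq, ← smul_add, skew_mul_skewDual_add, hpr, neg_mul, neg_neg,
        smul_smul]
    · rw [← hc, ← ha, Matrix.mulVec_smul, Matrix.mulVec_smul, ← Matrix.mulVec_mulVec,
        ← Matrix.mulVec_mulVec, e₃]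
  subst hb
  rw [Matrix.mulVec_zero] at ha hc
  exact ⟨(smul_eq_zero_iff_right half_ne).1 ha, rfl, (smul_eq_zero_iff_right half_ne).1 hc⟩

end Skew

/-- The components of a `2`-covector, in the order of the upper triangle of a matrix. -/
def comp2 (B : Cov 2) : Fin 6 → ℂ :=
  ![B ![stdB 0, stdB 1], B ![stdB 0, stdB 2], B ![stdB 0, stdB 3], B ![stdB 1, stdB 2],
    B ![stdB 1, stdB 3], B ![stdB 2, stdB 3]]

theorem pfaff_comp2 (A B : Cov 2) : pfaff (comp2 A) (comp2 B) = pair A B := by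
  simp only [pair, topCoeff_eq, wedgeCov_two_two, pfaff, comp2, Matrix.cons_val]

theorem skewDual_comp2_mulVec (α : Cov 1) (B : Cov 2) :
    (skewDual (comp2 B)).mulVec (fun i => α ![stdB i]) =
      ![wedgeCov (n := 3) rfl α B ![stdB 1, stdB 2, stdB 3],
        -wedgeCov (n := 3) rfl α B ![stdB 0, stdB 2, stdB 3],
        wedgeCov (n := 3) rfl α B ![stdB 0, stdB 1, stdB 3],
        -wedgeCov (n := 3) rfl α B ![stdB 0, stdB 1, stdB 2]] := by
  ext i
  fin_cases i <;>
    simp [skewDual, skew, comp2, Matrix.mulVec, dotProduct, Fin.sum_univ_four,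
      wedgeCov_one_two] <;> ring

theorem skewDual_comp2_mulVec_add {α β : Cov 1} {A B : Cov 2}
    (h : wedgeCov (n := 3) rfl α A + wedgeCov (n := 3) rfl β B = 0) :
    (skewDual (comp2 A)).mulVec (fun i => α ![stdB i]) +
      (skewDual (comp2 B)).mulVec (fun i => β ![stdB i]) = 0 := by
  simp only [skewDual_comp2_mulVec, eq_neg_of_add_eq_zero_left h,
    ContinuousAlternatingMap.neg_apply]
  ext i
  fin_cases i <;> simp

theorem cov_ext {p : ℕ} {α β : Cov p}
    (h : ∀ v : Fin p → Fin 4, Function.Injective v → α (stdB ∘ v) = β (stdB ∘ v)) : α = β := by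
  have basis_eq : ((EuclideanSpace.basisFun (Fin 4) ℝ).toBasis : Fin 4 → E4) = stdB := by
    ext i : 1
    simp [stdB]
  refine ContinuousAlternatingMap.toAlternatingMap_injective
    (Module.Basis.ext_alternating (EuclideanSpace.basisFun (Fin 4) ℝ).toBasis fun v hv => ?_)
  rw [basis_eq]
  exact h v hv

theorem cov_one_eq_zero {α : Cov 1} (h : (fun i => α ![stdB i]) = 0) : α = 0 :=
  cov_ext fun v _ => by
    rw [show stdB ∘ v = ![stdB (v 0)] from funext fun i => by fin_cases i; rfl]
    exact congrFun h (v 0)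

theorem eq_zero_of_topCoeff_eq_zero {μ : Cov 4} (h : topCoeff μ = 0) : μ = 0 :=
  cov_ext fun v hv => by
    set π := Equiv.ofBijective v (Finite.injective_iff_bijective.1 hv)
    calc μ (stdB ∘ π) = Equiv.Perm.sign π • topCoeff μ := μ.toAlternatingMap.map_perm stdB π
      _ = 0 := by rw [h, smul_zero]

theorem wedge_two_injective {P Q R : Cov 2} {a b c : Cov 1}
    (hpp : pair P P = 0) (hpq : pair P Q = 0) (hrq : pair R Q = 0)
    (hpr : pair P R = -2 * pair Q Q) (hq : pair Q Q ≠ 0)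
    (e₁ : wedgeCov (n := 3) rfl b P + wedgeCov (n := 3) rfl c Q = 0)
    (e₂ : wedgeCov (n := 3) rfl a Q + wedgeCov (n := 3) rfl b R = 0)
    (e₃ : wedgeCov (n := 3) rfl c R = wedgeCov (n := 3) rfl a P) :
    a = 0 ∧ b = 0 ∧ c = 0 := by
  simp only [← pfaff_comp2] at hpp hpq hrq hpr hq
  obtain ⟨ha, hb, hc⟩ := eq_zero_of_skewDual_mulVec hpp hpq hrq hpr hq
    (skewDual_comp2_mulVec_add e₁) (skewDual_comp2_mulVec_add e₂)
    (by simp only [skewDual_comp2_mulVec, e₃])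
  exact ⟨cov_one_eq_zero ha, cov_one_eq_zero hb, cov_one_eq_zero hc⟩

theorem continuousOn_wedgeCov {T : Type*} [TopologicalSpace T] {p q n : ℕ} (h : p + q = n)
    {f : T → Cov p} {g : T → Cov q} {s : Set T} (hf : ContinuousOn f s) (hg : ContinuousOn g s) :
    ContinuousOn (fun t => wedgeCov h (f t) (g t)) s :=
  ((wedgeL h).continuous.comp_continuousOn hf).clm_apply hg

section ActUpper

variable {p : ℕ} {Γ Γ' : SForm 1} {X X' : SForm p} {x : E4}

theorem actUpper_eq (Γ : SForm 1) (X : SForm p) (A B : Fin 2) (x : E4) :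
    actUpper Γ X A B x =
      wedge (Nat.add_comm 1 p) (raiseFirst Γ A 0) (X B 0) x +
        wedge (Nat.add_comm 1 p) (raiseFirst Γ B 0) (X A 0) x +
      (wedge (Nat.add_comm 1 p) (raiseFirst Γ A 1) (X B 1) x +
        wedge (Nat.add_comm 1 p) (raiseFirst Γ B 1) (X A 1) x) := by
  simp only [actUpper, Fin.sum_univ_two]

theorem actUpper_of_eq_smul {c d : ℝ} (hΓ : ∀ A B, Γ' A B x = c • Γ A B x)
    (hX : ∀ A B, X' A B x = d • X A B x) (A B : Fin 2) :
    actUpper Γ' X' A B x = (c * d) • actUpper Γ X A B x := by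
  have wedge_smul (α : Cov 1) (β : Cov p) : wedgeCov (Nat.add_comm 1 p) (c • α) (d • β) =
      (c * d) • wedgeCov (Nat.add_comm 1 p) α β := by
    change wedgeL (Nat.add_comm 1 p) (c • α) (d • β) = (c * d) • wedgeL (Nat.add_comm 1 p) α β
    rw [map_smul, map_smul, _root_.smul_apply, mul_smul, smul_comm]
  have raise (A B) : raiseFirst Γ' A B x = c • raiseFirst Γ A B x := by
    simp only [raiseFirst, hΓ, Finset.smul_sum, smul_comm c]
  simp only [actUpper, wedge, raise, hX, wedge_smul]
  ext v
  simp only [Fin.sum_univ_two, ContinuousAlternatingMap.add_apply,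
    ContinuousAlternatingMap.smul_apply, smul_add]

theorem eq_zero_of_actUpper_eq_zero {γ : SForm 1} {S : SForm 2} (hS : ∀ A B, S A B x = S B A x)
    (simple : ∀ I, symWedge S S I x = 0) (hvol : volForm S x ≠ 0) (hγ : γ 1 0 x = γ 0 1 x)
    (h : ∀ A B, actUpper γ S A B x = 0) (A B : Fin 2) : γ A B x = 0 := by
  obtain ⟨pair_00, pair_01, pair_02, pair_12, -⟩ := pair_of_symWedge_self_eq_zero hS simple
  have pair_11 : pair (S 0 1 x) (S 0 1 x) ≠ 0 := fun pair_zero =>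
    hvol (eq_zero_of_topCoeff_eq_zero (by
      rw [topCoeff_volForm hS simple, pair_zero, neg_zero]))
  have e₀₀ := h 0 0
  have e₀₁ := h 0 1
  have e₁₁ := h 1 1
  simp only [actUpper_eq, raiseFirst_zero, raiseFirst_one, wedge, Pi.neg_apply, wedgeCov_neg_left,
    hγ, hS 1 0] at e₀₀ e₀₁ e₁₁
  obtain ⟨h₀₀, h₀₁, h₁₁⟩ := wedge_two_injective pair_00 pair_01 (pair_comm _ _ ▸ pair_12) pair_02
    pair_11 (a := γ 0 0 x) (b := γ 0 1 x) (c := γ 1 1 x)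
    ((smul_eq_zero_iff_right (two_ne_zero' ℝ)).1 (by rw [← e₀₀]; module))
    ((smul_eq_zero_iff_right (neg_ne_zero.2 (two_ne_zero' ℝ))).1 (by rw [← e₁₁]; module))
    (sub_eq_zero.1 (by rw [← e₀₁]; module))
  revert A B
  simp only [Fin.forall_fin_two, hγ]
  exact ⟨⟨h₀₀, h₀₁⟩, h₀₁, h₁₁⟩

end ActUpper

/-! ### Uniform estimates -/

open Asymptotics

theorem exists_norm_le_of_homogeneous {X V W : Type*} [TopologicalSpace X] [NormedAddCommGroup V]
    [NormedSpace ℝ V] [FiniteDimensional ℝ V] [NormedAddCommGroup W] [NormedSpace ℝ W]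
    {K : Set X} (hK : IsCompact K) {L : X → V → W}
    (hL : ContinuousOn (fun z : X × V => L z.1 z.2) (K ×ˢ univ))
    (smul : ∀ x ∈ K, ∀ (c : ℝ) v, L x (c • v) = c • L x v)
    (injective : ∀ x ∈ K, ∀ v, L x v = 0 → v = 0) :
    ∃ C, ∀ x ∈ K, ∀ v, ‖v‖ ≤ C * ‖L x v‖ := by
  obtain ⟨m, hm, hle⟩ := (hK.prod (isCompact_sphere (0 : V) 1)).exists_forall_le'
    (hL.norm.mono (prod_mono_right (subset_univ _))) (a := 0) fun z hz => by
      refine norm_pos_iff.2 fun L_zero => ne_zero_of_mem_unit_sphere ⟨z.2, hz.2⟩ ?_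
      exact injective z.1 hz.1 z.2 L_zero
  refine ⟨m⁻¹, fun x hx v => ?_⟩
  rcases eq_or_ne v 0 with rfl | hv
  · simpa using mul_nonneg (inv_nonneg.2 hm.le) (norm_nonneg (L x 0))
  have unit : m ≤ ‖v‖⁻¹ * ‖L x v‖ := by
    have h := hle (x, ‖v‖⁻¹ • v) ⟨hx, by simp [norm_smul, hv]⟩
    rwa [smul x hx, norm_smul, norm_inv, norm_norm] at h
  rwa [le_inv_mul_iff₀ hm, mul_comm, ← le_inv_mul_iff₀ (norm_pos_iff.2 hv)]

theorem isBigO_of_isBigO_actUpper {K : Set E4} (hK : IsCompact K) {S : SForm 2}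
    (cont : ∀ A B, ContinuousOn (S A B) K) (symm : ∀ x ∈ K, ∀ A B, S A B x = S B A x)
    (simple : ∀ x ∈ K, ∀ I, symWedge S S I x = 0) (hvol : ∀ x ∈ K, volForm S x ≠ 0)
    {γ : SForm 1} (hγ : ∀ A B, γ A B = γ B A) {l : Filter E4} (hl : l ≤ 𝓟 K) {f : E4 → ℝ}
    (h : ∀ A B, actUpper γ S A B =O[l] f) (A B : Fin 2) : γ A B =O[l] f := by
  -- The second component forces the symmetry of `γ`, without which the first is not injective.
  let L (x : E4) (v : Fin 2 → Fin 2 → Cov 1) : (Fin 2 → Fin 2 → Cov 3) × Cov 1 :=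
    (fun A B => actUpper (fun A B _ => v A B) S A B x, v 1 0 - v 0 1)
  have contL : ContinuousOn (fun z : E4 × (Fin 2 → Fin 2 → Cov 1) => L z.1 z.2) (K ×ˢ univ) := by
    have contW (A B C D) : ContinuousOn (fun z : E4 × (Fin 2 → Fin 2 → Cov 1) =>
        wedgeCov (Nat.add_comm 1 2) (raiseFirst (fun A B _ => z.2 A B) A B z.1) (S C D z.1))
        (K ×ˢ univ) := by
      refine continuousOn_wedgeCov _ ?_ ((cont C D).comp continuousOn_fst fun z hz => hz.1)
      exact continuousOn_finsetSum _ fun E _ =>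
        ((continuous_apply_apply E B).comp continuous_snd).continuousOn.const_smul (eps A E)
    refine .prodMk (continuousOn_pi.2 fun A => continuousOn_pi.2 fun B => ?_)
      (((continuous_apply_apply 1 0).comp continuous_snd).sub
        ((continuous_apply_apply 0 1).comp continuous_snd)).continuousOn
    exact continuousOn_finsetSum _ fun C _ => (contW A C B C).add (contW B C A C)
  obtain ⟨C, hC⟩ := exists_norm_le_of_homogeneous hK contL
    (fun x _ c v => Prod.ext
      (funext₂ fun A B => (actUpper_of_eq_smul (c := c) (d := 1) (fun _ _ => rfl)
        (fun _ _ => (one_smul ℝ _).symm) A B).trans (by rw [mul_one]; rfl))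
      (smul_sub c (v 1 0) (v 0 1)).symm)
    (fun x hx v hv => funext₂ <| eq_zero_of_actUpper_eq_zero (γ := fun A B _ => v A B) (symm x hx)
      (simple x hx) (hvol x hx) (sub_eq_zero.1 (congrArg Prod.snd hv))
      fun A B => congrFun₂ (congrArg Prod.fst hv) A B)
  have bound : (fun x A B => γ A B x) =O[l] fun x => L x fun A B => γ A B x :=
    IsBigO.of_bound C (hl fun x hx => hC x hx _)
  have L_isBigO : (fun x => L x fun A B => γ A B x) =O[l] f := by
    refine (isBigO_pi.2 fun A => isBigO_pi.2 fun B => h A B).prod_left ?_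
    simp only [hγ 1 0, sub_self]
    exact isBigO_zero _ _
  exact isBigO_pi.1 (isBigO_pi.1 (bound.trans L_isBigO) A) B

theorem isBigO_fderiv_one {V W : Type*} [NormedAddCommGroup V] [NormedSpace ℝ V]
    [NormedAddCommGroup W] [NormedSpace ℝ W] {f : V → W} {s K : Set V} (hf : ContDiffOn ℝ 1 f s)
    (hK : IsCompact K) (hKs : K ⊆ s) : fderiv ℝ f =O[𝓟 (K ∩ interior s)] (1 : V → ℝ) := by
  refine hK.induction_on (p := fun t => fderiv ℝ f =O[𝓟 (t ∩ interior s)] (1 : V → ℝ))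
    (by simp) (fun t t' htt' h => h.mono (by gcongr)) (fun t t' h h' => ?_) fun x hx => ?_
  · rw [union_inter_distrib_right, ← sup_principal]
    exact h.sup h'
  · have hf : ContDiffWithinAt ℝ (0 + 1) f s x := by simpa using hf x (hKs hx)
    obtain ⟨u, hu, -, -, f', hf', hcont⟩ :=
      (contDiffWithinAt_succ_iff_hasFDerivWithinAt' (by simp)).1 hf
    rw [insert_eq_of_mem (hKs hx)] at hu
    have bounded : ∀ᶠ y in 𝓝[s] x, ‖f' y‖ < ‖f' x‖ + 1 :=
      hcont.continuousWithinAt.norm.eventually_lt_const (lt_add_one _)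
    refine ⟨{y | y ∈ u ∧ ‖f' y‖ < ‖f' x‖ + 1}, nhdsWithin_mono x hKs (inter_mem hu bounded),
      IsBigO.of_bound (‖f' x‖ + 1) fun y ⟨hy, hys⟩ => ?_⟩
    rw [mem_ofPred_eq, ((hf' y hy.1).hasFDerivAt (mem_interior_iff_mem_nhds.1 hys)).fderiv]
    simpa using hy.2.le

theorem isBigO_wedge {p q n : ℕ} (h : p + q = n) {α : Form p} {β : Form q} {l : Filter E4}
    {f g : E4 → ℝ} (hα : α =O[l] f) (hβ : β =O[l] g) : wedge h α β =O[l] fun x => f x * g x :=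
  ((wedgeL h).isBoundedBilinearMap.isBigO_comp).trans (hα.norm_left.mul hβ.norm_left)

theorem isBigO_lower {p : ℕ} {X : SForm p} {l : Filter E4} {f : E4 → ℝ}
    (h : ∀ A B, X A B =O[l] f) (A B : Fin 2) : lower X A B =O[l] f :=
  IsBigO.fun_sum fun C _ => IsBigO.fun_sum fun D _ => (h C D).const_smul_left (eps C A * eps D B)

theorem isBigO_contract {p q n : ℕ} (h : p + q = n) {X : SForm p} {Y : SForm q} {l : Filter E4}
    {f g : E4 → ℝ} (hX : ∀ A B, X A B =O[l] f) (hY : ∀ A B, Y A B =O[l] g) :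
    contract h X Y =O[l] fun x => f x * g x :=
  IsBigO.fun_sum fun A _ => IsBigO.fun_sum fun B _ => isBigO_wedge h (hX A B) (hY A B)

theorem isBigO_actUpper {p : ℕ} {Γ : SForm 1} {X : SForm p} {l : Filter E4} {f g : E4 → ℝ}
    (hΓ : ∀ A B, Γ A B =O[l] f) (hX : ∀ A B, X A B =O[l] g) (A B : Fin 2) :
    actUpper Γ X A B =O[l] fun x => f x * g x := by
  have raise (A B) : raiseFirst Γ A B =O[l] f :=
    IsBigO.fun_sum fun C _ => (hΓ C B).const_smul_left (eps A C)
  exact IsBigO.fun_sum fun C _ =>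
    (isBigO_wedge _ (raise A C) (hX B C)).add (isBigO_wedge _ (raise B C) (hX A C))

theorem isBigO_extDeriv {p : ℕ} (α : Form p) (l : Filter E4) : extDeriv α =O[l] fderiv ℝ α :=
  IsBigO.of_bound (p + 1) (.of_forall fun _ =>
    ContinuousAlternatingMap.norm_alternatizeUncurryFin_le _)

/-! ### Asymptotics at the conformal boundary -/

theorem M_subset_Mbar : M ⊆ Mbar := fun _ hx => ⟨hx.1.le, hx.2.le⟩

theorem isCompact_preimage_norm {V : Type*} [NormedAddCommGroup V] [ProperSpace V] {s : Set ℝ}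
    (hs : IsCompact s) : IsCompact (norm ⁻¹' s : Set V) := by
  obtain ⟨C, hC⟩ := hs.isBounded.subset_closedBall 0
  refine (isCompact_closedBall (0 : V) C).of_isClosed_subset
    (hs.isClosed.preimage continuous_norm) fun x hx => ?_
  simpa using hC hx

theorem isCompact_Mbar : IsCompact Mbar := isCompact_preimage_norm (isCompact_Icc (a := (1 : ℝ)))

theorem Mbar_subset_closure : Mbar ⊆ closure M := by
  intro x hx
  have norm_pos : 0 < ‖x‖ := one_pos.trans_le hx.1
  have segment_subset : openSegment ℝ x ((3 / 2 / ‖x‖) • x) ⊆ M := by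
    rintro _ ⟨a, b, ha, hb, hab, rfl⟩
    have norm_eq : ‖a • x + b • (3 / 2 / ‖x‖) • x‖ = a * ‖x‖ + b * (3 / 2) := by
      rw [smul_smul, ← add_smul, norm_smul, Real.norm_of_nonneg (by positivity)]
      field_simp
    obtain ⟨h₁, h₂⟩ := hx
    constructor <;> rw [norm_eq] <;> nlinarith
  refine closure_mono segment_subset ?_
  rw [closure_openSegment]
  exact left_mem_segment ℝ _ _

section ExtendsSmoothly

variable {V : Type*} [NormedAddCommGroup V] [NormedSpace ℝ V] {f : E4 → V} {t K : Set E4}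

theorem ExtendsSmoothly.isBigO_one (hf : ExtendsSmoothly f M t) (hK : IsCompact K) (hKt : K ⊆ t) :
    f =O[𝓟 (K ∩ M)] (1 : E4 → ℝ) := by
  obtain ⟨g, hg, hgf⟩ := hf
  refine (((hg.continuousOn.mono hKt).isBigO_principal hK (c := (1 : ℝ)) (by simp)).mono
    (principal_mono.2 inter_subset_left)).congr' ?_ .rfl
  exact eventuallyEq_principal.2 (hgf.mono inter_subset_right)

theorem ExtendsSmoothly.isBigO_fderiv_one (hf : ExtendsSmoothly f M t) (hMt : M ⊆ t)
    (hK : IsCompact K) (hKt : K ⊆ t) : fderiv ℝ f =O[𝓟 (K ∩ M)] (1 : E4 → ℝ) := by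
  obtain ⟨g, hg, hgf⟩ := hf
  refine ((MHV.isBigO_fderiv_one (hg.of_le (by simp)) hK hKt).mono (principal_mono.2
    (inter_subset_inter_right K (isOpen_M.subset_interior_iff.2 hMt)))).congr' ?_ .rfl
  refine eventuallyEq_principal.2 fun x hx => ?_
  exact (hgf.eventuallyEq_of_mem (isOpen_M.mem_nhds hx.2)).fderiv_eq

end ExtendsSmoothly

theorem isBigO_one_of_contDiffOn {V : Type*} [NormedAddCommGroup V] [NormedSpace ℝ V] {f : E4 → V}
    (hf : ContDiffOn ℝ ∞ f Mbar) : f =O[𝓟 M] (1 : E4 → ℝ) := by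
  simpa only [inter_eq_right.2 M_subset_Mbar] using
    ExtendsSmoothly.isBigO_one ⟨f, hf, fun _ _ => rfl⟩ isCompact_Mbar subset_rfl

theorem isBigO_fderiv_one_of_contDiffOn {V : Type*} [NormedAddCommGroup V] [NormedSpace ℝ V]
    {f : E4 → V} (hf : ContDiffOn ℝ ∞ f Mbar) : fderiv ℝ f =O[𝓟 M] (1 : E4 → ℝ) := by
  simpa only [inter_eq_right.2 M_subset_Mbar] using
    ExtendsSmoothly.isBigO_fderiv_one ⟨f, hf, fun _ _ => rfl⟩ M_subset_Mbar isCompact_Mbar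
      subset_rfl

/-- Multiplying by `Ω³` rather than `Ω²` avoids dividing by the conformal factor, since
`Ω³ f' = Ω (Ω² f)' - 2 (Ω² f) Ω'`. -/
theorem isBigO_pow_three_mul_norm_fderiv {V : Type*} [NormedAddCommGroup V] [NormedSpace ℝ V]
    {Ω : E4 → ℝ} {f g : E4 → V} (hΩ : ContDiffOn ℝ ∞ Ω Mbar) (hf : ContDiffOn ℝ ∞ f M)
    (hg : ContDiffOn ℝ ∞ g Mbar) (eq_smul : ∀ x ∈ M, g x = Ω x ^ 2 • f x) :
    (fun x => Ω x ^ 3 * ‖fderiv ℝ f x‖) =O[𝓟 M] (1 : E4 → ℝ) := by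
  have fderiv_eq : ∀ x ∈ M, Ω x ^ 3 • fderiv ℝ f x =
      Ω x • fderiv ℝ g x - (2 : ℝ) • (fderiv ℝ Ω x).smulRight (g x) := by
    intro x hx
    have dΩ : DifferentiableAt ℝ Ω x :=
      differentiableAt_of_contDiffOn_M (hΩ.mono M_subset_Mbar) hx
    have df : DifferentiableAt ℝ f x := differentiableAt_of_contDiffOn_M hf hx
    have eventually_eq : g =ᶠ[𝓝 x] fun y => Ω y ^ 2 • f y := by
      filter_upwards [isOpen_M.mem_nhds hx] with y hy using eq_smul y hy
    rw [eventually_eq.fderiv_eq, fderiv_fun_smul (dΩ.fun_pow 2) df, fderiv_fun_pow 2 dΩ,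
      eq_smul x hx]
    ext v
    simp only [_root_.smul_apply, _root_.add_apply, _root_.sub_apply,
      ContinuousLinearMap.smulRight_apply, smul_eq_mul, Nat.add_one_sub_one, pow_one]
    module
  have h₁ : (fun x => Ω x • fderiv ℝ g x) =O[𝓟 M] (1 : E4 → ℝ) :=
    ((isBigO_one_of_contDiffOn hΩ).smul
      (isBigO_fderiv_one_of_contDiffOn hg)).congr_right fun _ => mul_one _
  have h₂ : (fun x => (fderiv ℝ Ω x).smulRight (g x)) =O[𝓟 M] (1 : E4 → ℝ) := by
    refine isBigO_norm_left.1 ?_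
    simp only [ContinuousLinearMap.norm_smulRight_apply]
    exact ((isBigO_fderiv_one_of_contDiffOn hΩ).norm_left.mul
      (isBigO_one_of_contDiffOn hg).norm_left).congr_right fun _ => mul_one _
  refine isBigO_norm_left.1 ?_
  simp only [norm_mul, norm_norm, ← norm_smul]
  exact (h₁.sub (h₂.const_smul_left (2 : ℝ))).norm_left.congr'
    (eventuallyEq_principal.2 fun x hx => congrArg norm (fderiv_eq x hx).symm) .rfl

/-- `S'` is the smooth extension to the compactification of the rescaled two-forms `Ω² Σ₀`, together
with the algebraic constraints that it inherits from `Σ₀`. -/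
structure IsRescaledBackground (Ω : E4 → ℝ) (S S' : SForm 2) : Prop where
  smooth : ∀ A B, ContDiffOn ℝ ∞ (S' A B) Mbar
  eq_smul : ∀ A B, ∀ x ∈ M, S' A B x = Ω x ^ 2 • S A B x
  symm : ∀ x ∈ Mbar, ∀ A B, S' A B x = S' B A x
  simplicity : ∀ x ∈ Mbar, ∀ I, symWedge S' S' I x = 0
  nondegenerate : ∀ x ∈ Mbar, volForm S' x ≠ 0

theorem symWedge_self_of_eq_smul {S S' : SForm 2} {x : E4} {c : ℝ}
    (h : ∀ A B, S' A B x = c • S A B x) (I : Fin 4 → Fin 2) :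
    symWedge S' S' I x = c ^ 2 • symWedge S S I x := by
  have wedge_smul (α β : Cov 2) : wedgeCov (n := 4) rfl (c • α) (c • β) =
      c ^ 2 • wedgeCov rfl α β := by
    change wedgeL (n := 4) rfl (c • α) (c • β) = c ^ 2 • wedgeL rfl α β
    rw [map_smul, map_smul, _root_.smul_apply, smul_smul, sq]
  simp only [symWedge, wedge, h, wedge_smul, Finset.smul_sum]

theorem continuousOn_topCoeff {α : Form 4} {s : Set E4} (hα : ContinuousOn α s) :
    ContinuousOn (fun x => topCoeff (α x)) s :=
  (ContinuousAlternatingMap.apply ℝ E4 ℂ stdB).continuous.comp_continuousOn hα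

section Background

variable {Λ : ℝ} {S S' : SForm 2} {Γ : SForm 1} {Ω : E4 → ℝ} {h h' : Perturbation}

theorem IsConformalCompactification.exists_isRescaledBackground
    (hΩ : IsConformalCompactification Ω S) (hbg : IsSelfDualBackground Λ S Γ) :
    ∃ S', IsRescaledBackground Ω S S' := by
  obtain ⟨S', smooth, eq_smul, nondegenerate⟩ := hΩ.rescaled
  refine ⟨S', smooth, eq_smul, fun x hx A B => ?_, fun x hx I => ?_, nondegenerate⟩
  · refine EqOn.of_subset_closure (fun y hy => ?_) (smooth A B).continuousOn
      (smooth B A).continuousOn M_subset_Mbar Mbar_subset_closure hx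
    rw [eq_smul A B y hy, eq_smul B A y hy, hbg.symm_S A B]
  · refine EqOn.of_subset_closure (g := 0) (fun y hy => ?_) (continuousOn_finsetSum _ fun π _ =>
      (contDiffOn_wedge rfl (smooth _ _) (smooth _ _)).continuousOn) continuousOn_const
      M_subset_Mbar Mbar_subset_closure hx
    change symWedge S' S' I y = 0
    rw [symWedge_self_of_eq_smul fun A B => eq_smul A B y hy, hbg.simplicity I y hy]
    exact smul_zero (M := ℝ) (A := Cov 4) _

theorem isBigO_smul_connection (hbg : IsSelfDualBackground Λ S Γ)
    (hΩ : IsConformalCompactification Ω S) (A B : Fin 2) :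
    (fun x => Ω x • Γ A B x) =O[𝓟 M] (1 : E4 → ℝ) := by
  obtain ⟨S', hS'⟩ := hΩ.exists_isRescaledBackground hbg
  refine isBigO_of_isBigO_actUpper (γ := fun A B x => Ω x • Γ A B x) isCompact_Mbar
    (fun A B => (hS'.smooth A B).continuousOn) hS'.symm hS'.simplicity hS'.nondegenerate
    (fun A B => by simp only [hbg.symm_Γ A B]) (principal_mono.2 M_subset_Mbar) (fun A B => ?_) A B
  refine IsBigO.trans ?_ (isBigO_pow_three_mul_norm_fderiv hΩ.smooth (hbg.smooth_S A B)
    (hS'.smooth A B) (hS'.eq_smul A B))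
  refine IsBigO.of_bound (2 + 1) (eventually_principal.2 fun x hx => ?_)
  have torsion_free : actUpper Γ S A B x = - extDeriv (S A B) x :=
    eq_neg_of_add_eq_zero_right (hbg.torsion_free A B x hx)
  rw [actUpper_of_eq_smul (c := Ω x) (d := Ω x ^ 2) (fun _ _ => rfl)
    (fun A B => hS'.eq_smul A B x hx), torsion_free, ← pow_succ', norm_smul, norm_neg, norm_mul,
    norm_norm, mul_left_comm]
  gcongr
  exact_mod_cast ContinuousAlternatingMap.norm_alternatizeUncurryFin_le _

/-- Approach to the component `scri ρ` of the conformal boundary from within `M`. -/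
def nhdsScri (ρ : ℝ) : Filter E4 := comap norm (𝓝[Ioo 1 2] ρ)

theorem nhdsScri_le_principal (ρ : ℝ) : nhdsScri ρ ≤ 𝓟 M :=
  (comap_mono inf_le_right).trans comap_principal.le

theorem exists_isCompact_nhdsScri_le {ρ : ℝ} (hρ : ρ = 1 ∨ ρ = 2) :
    ∃ K, IsCompact K ∧ K ⊆ M ∪ scri ρ ∧ nhdsScri ρ ≤ 𝓟 (K ∩ M) := by
  refine ⟨norm ⁻¹' (Icc 1 2 ∩ Metric.closedBall ρ (1 / 2)), isCompact_preimage_norm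
    (isCompact_Icc.inter (isCompact_closedBall ρ _)), fun x hx => ?_, ?_⟩
  · obtain ⟨⟨h₁, h₂⟩, h₃⟩ := hx
    rw [Real.closedBall_eq_Icc] at h₃
    simp only [M, scri, mem_union, mem_ofPred_eq, mem_sphere_zero_iff_norm]
    rcases hρ with rfl | rfl <;> grind
  · rw [← inf_principal]
    refine le_inf ?_ (nhdsScri_le_principal ρ)
    rw [le_principal_iff, preimage_inter]
    refine inter_mem (mem_of_superset (nhdsScri_le_principal ρ (mem_principal_self M))
      M_subset_Mbar) ?_
    exact preimage_mem_comap (mem_nhdsWithin_of_mem_nhds (Metric.closedBall_mem_nhds ρ (by simp)))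

theorem tendsto_of_isCompact_of_eq {X Y Z : Type*} [TopologicalSpace X] [TopologicalSpace Y]
    [T2Space Y] [TopologicalSpace Z] {K : Set X} (hK : IsCompact K) {f : X → Z} {g : X → Y}
    (hf : ContinuousOn f K) (hg : ContinuousOn g K) {y : Y} {z : Z}
    (h : ∀ x ∈ K, g x = y → f x = z) : Tendsto f (comap g (𝓝 y) ⊓ 𝓟 K) (𝓝 z) := by
  refine tendsto_iff_ultrafilter _ _ _ |>.2 fun u hu => ?_
  obtain ⟨hug, huK⟩ := le_inf_iff.1 hu
  obtain ⟨x, hxK, hux⟩ := hK.ultrafilter_le_nhds u huK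
  have u_le : (u : Filter X) ≤ 𝓝[K] x := le_inf hux huK
  rw [← h x hxK (tendsto_nhds_unique ((hg x hxK).mono_left u_le) (tendsto_iff_comap.2 hug))]
  exact (hf x hxK).mono_left u_le

theorem IsConformalCompactification.tendsto_zero (hΩ : IsConformalCompactification Ω S) {ρ : ℝ}
    (hρ : ρ = 1 ∨ ρ = 2) : Tendsto Ω (nhdsScri ρ) (𝓝 0) := by
  refine (tendsto_of_isCompact_of_eq isCompact_Mbar hΩ.smooth.continuousOn
    continuous_norm.continuousOn (y := ρ) fun x _ hx => hΩ.eq_zero x ?_).mono_left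
    (le_inf (comap_mono nhdsWithin_le_nhds)
      ((nhdsScri_le_principal ρ).trans (principal_mono.2 M_subset_Mbar)))
  rcases hρ with rfl | rfl <;> simp [scri, hx]

/-- A regular `σ` forces `γ` to vanish at the boundary, because the torsion map of the rescaled
background is invertible uniformly up to the boundary. -/
theorem IsScatteringState.isBigO_γ (hbg : IsSelfDualBackground Λ S Γ)
    (hΩ : IsConformalCompactification Ω S) (hh : IsScatteringState Λ S Γ Ω h) {ρ : ℝ}
    (hρ : ρ = 1 ∨ ρ = 2) (hσ : ∀ A B, ExtendsSmoothly (h.σ A B) M (M ∪ scri ρ)) (A B : Fin 2) :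
    h.γ A B =O[nhdsScri ρ] Ω := by
  obtain ⟨S', hS'⟩ := hΩ.exists_isRescaledBackground hbg
  obtain ⟨K, hK, hKρ, le_K⟩ := exists_isCompact_nhdsScri_le hρ
  refine isBigO_of_isBigO_actUpper isCompact_Mbar (fun A B => (hS'.smooth A B).continuousOn)
    hS'.symm hS'.simplicity hS'.nondegenerate hh.symm_γ
    ((nhdsScri_le_principal ρ).trans (principal_mono.2 M_subset_Mbar)) (fun A B => ?_) A B
  have dσ_isBigO : (fun x => Ω x • extDeriv (h.σ A B) x) =O[nhdsScri ρ] (1 : E4 → ℝ) := by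
    exact (((isBigO_one_of_contDiffOn hΩ.smooth).mono (nhdsScri_le_principal ρ)).smul
      ((isBigO_extDeriv _ _).trans (((hσ A B).isBigO_fderiv_one subset_union_left hK hKρ).mono
        le_K))).congr_right fun _ => mul_one _
  have act_isBigO : actUpper (fun A B x => Ω x • Γ A B x) h.σ A B =O[nhdsScri ρ] (1 : E4 → ℝ) := by
    exact (isBigO_actUpper
      (fun A B => (isBigO_smul_connection hbg hΩ A B).mono (nhdsScri_le_principal ρ))
      (fun A B => ((hσ A B).isBigO_one hK hKρ).mono le_K) A B).congr_right fun _ => mul_one _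
  have torsion_eq : ∀ x ∈ M, actUpper h.γ S' A B x =
      -(Ω x • (Ω x • extDeriv (h.σ A B) x + actUpper (fun A B x => Ω x • Γ A B x) h.σ A B x)) := by
    intro x hx
    rw [actUpper_of_eq_smul (Γ := h.γ) (c := 1) (d := Ω x ^ 2) (fun _ _ => (one_smul ℝ _).symm)
        (fun A B => hS'.eq_smul A B x hx),
      actUpper_of_eq_smul (Γ := Γ) (X := h.σ) (c := Ω x) (d := 1) (fun _ _ => rfl)
        (fun _ _ => (one_smul ℝ _).symm),
      ← neg_eq_iff_eq_neg.2 (hh.lin_torsion A B x hx), covDUpper]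
    module
  have rhs_isBigO := ((isBigO_refl Ω (nhdsScri ρ)).smul (dσ_isBigO.add act_isBigO)).neg_left
  refine (rhs_isBigO.congr' (.symm ?_) .rfl).trans (by simpa using isBigO_refl Ω _)
  exact (eventuallyEq_principal.2 torsion_eq).filter_mono (nhdsScri_le_principal ρ)

theorem IsScatteringState.extendsSmoothly_weylForm
    (hΩ : IsConformalCompactification Ω S) (hh : IsScatteringState Λ S Γ Ω h) (A B : Fin 2) :
    ExtendsSmoothly (weylForm h.ψ S A B) M Mbar := by
  obtain ⟨S', smooth, eq_smul, -⟩ := hΩ.rescaled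
  obtain ⟨φ, hφ, hφψ⟩ := hh.regular_ψ
  refine ⟨weylForm φ S' A B, contDiffOn_weylForm hφ smooth A B, fun x hx => ?_⟩
  refine Finset.sum_congr rfl fun C _ => Finset.sum_congr rfl fun D _ => ?_
  rw [hφψ hx, eq_smul C D x hx]
  change ((Ω x ^ 2)⁻¹ • h.ψ x ![A, B, C, D]) • Ω x ^ 2 • S C D x = _
  rw [smul_comm, smul_assoc, smul_smul,
    mul_inv_cancel₀ (pow_ne_zero 2 (hΩ.ne_zero x hx)), one_smul]

theorem tendsto_current_zero (hbg : IsSelfDualBackground Λ S Γ)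
    (hΩ : IsConformalCompactification Ω S) (hh : IsScatteringState Λ S Γ Ω h)
    (hh' : IsScatteringState Λ S Γ Ω h') {ρ : ℝ} (hρ : ρ = 1 ∨ ρ = 2)
    (hσ : ∀ A B, ExtendsSmoothly (h.σ A B) M (M ∪ scri ρ)) :
    Tendsto (current S h h') (nhdsScri ρ) (𝓝 0) := by
  have weylForm_isBigO (A B) : weylForm h'.ψ S A B =O[nhdsScri ρ] (1 : E4 → ℝ) :=
    ((hh'.extendsSmoothly_weylForm hΩ A B).isBigO_one isCompact_Mbar subset_rfl).mono (by
      simpa only [inter_eq_right.2 M_subset_Mbar] using nhdsScri_le_principal ρ)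
  have current_isBigO : current S h h' =O[nhdsScri ρ] fun x => Ω x * 1 :=
    isBigO_contract rfl (hh.isBigO_γ hbg hΩ hρ hσ) (isBigO_lower weylForm_isBigO)
  exact current_isBigO.trans_tendsto (by simpa using hΩ.tendsto_zero hρ)

theorem integrableOn_cgDensity (hbg : IsSelfDualBackground Λ S Γ)
    (hΩ : IsConformalCompactification Ω S) (hh : IsScatteringState Λ S Γ Ω h)
    (hh' : IsScatteringState Λ S Γ Ω h') : IntegrableOn (cgDensity S h h') M := by
  choose Ψ hΨ hΨψ using hh.extendsSmoothly_weylForm hΩ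
  choose Ψ' hΨ' hΨψ' using hh'.extendsSmoothly_weylForm hΩ
  have cont : ContinuousOn (fun x => 2⁻¹ * topCoeff (contract (n := 4) rfl Ψ (lower Ψ') x)) Mbar :=
    continuousOn_const.mul (continuousOn_topCoeff
      (contDiffOn_contract rfl hΨ (contDiffOn_lower hΨ')).continuousOn)
  have integrand_eq : EqOn (fun x => 2⁻¹ * topCoeff (contract (n := 4) rfl Ψ (lower Ψ') x))
      (cgDensity S h h') M := by
    intro x hx
    have contract_eq : contract (n := 4) rfl Ψ (lower Ψ') x =
        contract (n := 4) rfl (weylForm h.ψ S) (lower (weylForm h'.ψ S)) x := by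
      simp only [contract, wedge, lower, hΨψ _ _ hx, hΨψ' _ _ hx]
    change 2⁻¹ * topCoeff _ = _
    rw [contract_eq, topCoeff_contract_weylForm_weylForm hh.symm_ψ hh'.symm_ψ hbg.symm_S
      fun I => hbg.simplicity I x hx]
    exact inv_mul_cancel_left₀ two_ne_zero _
  exact ((cont.integrableOn_compact isCompact_Mbar).mono_set M_subset_Mbar).congr_fun integrand_eq
    isOpen_M.measurableSet

end Background

/-! ### Polar coordinates and Stokes' theorem on slices -/

section IntegrationByParts

variable {V : Type*} [NormedAddCommGroup V] [NormedSpace ℝ V]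

theorem integrable_smul_of_tsupport_subset {X : Type*} [TopologicalSpace X] [MeasurableSpace X]
    [OpensMeasurableSpace X] {μ : Measure X}
    [IsFiniteMeasureOnCompacts μ] {U : Set X} (hU : IsOpen U) {φ : X → ℝ} (hφ : Continuous φ)
    (hc : HasCompactSupport φ) (hφU : tsupport φ ⊆ U) {f : X → V} (hf : ContinuousOn f U) :
    Integrable (fun x => φ x • f x) μ := by
  have tsupport_subset : tsupport (fun x => φ x • f x) ⊆ tsupport φ :=
    tsupport_smul_subset_left φ f
  refine Continuous.integrable_of_hasCompactSupport (continuous_of_tsupport fun x hx => ?_)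
    (hc.mono' (subset_closure.trans tsupport_subset))
  exact hφ.continuousAt.smul (hf.continuousAt (hU.mem_nhds (hφU (tsupport_subset hx))))

theorem hasDerivAt_of_integral_smul_eq [CompleteSpace V] {s : Set ℝ} (hs : IsOpen s) {W D : ℝ → V}
    (hW : ContDiffOn ℝ 1 W s) (hD : ContinuousOn D s)
    (h : ∀ φ : ℝ → ℝ, ContDiff ℝ ∞ φ → HasCompactSupport φ → tsupport φ ⊆ s →
      ∫ r, φ r • D r = -∫ r, deriv φ r • W r) {r : ℝ} (hr : r ∈ s) : HasDerivAt W (D r) r := by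
  have hW' : ContinuousOn (deriv W) s := hW.continuousOn_deriv_of_isOpen hs le_rfl
  have hWd {r : ℝ} (hr : r ∈ s) : DifferentiableAt ℝ W r :=
    (hW.contDiffAt (hs.mem_nhds hr)).differentiableAt one_ne_zero
  suffices EqOn (deriv W) D s by simpa only [this hr] using (hWd hr).hasDerivAt
  refine Measure.eqOn_open_of_ae_eq (μ := volume) ?_ hs hW' hD
  rw [EventuallyEq, ae_restrict_iff' hs.measurableSet]
  have ae_zero := hs.ae_eq_zero_of_integral_contDiff_smul_eq_zero (μ := volume)
    (f := fun r => deriv W r - D r)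
    ((hW'.sub hD).locallyIntegrableOn (μ := volume) hs.measurableSet) fun φ hφ hc hφs => ?_
  · filter_upwards [ae_zero] with r h hr using sub_eq_zero.1 (h hr)
  have integrable_smul {f : ℝ → V} (hf : ContinuousOn f s) : Integrable fun r => φ r • f r :=
    integrable_smul_of_tsupport_subset hs hφ.continuous hc hφs hf
  have integrable_deriv_smul : Integrable fun r => deriv φ r • W r :=
    integrable_smul_of_tsupport_subset hs (hφ.continuous_deriv (by simp)) hc.deriv
      (tsupport_deriv_subset.trans hφs) hW.continuousOn
  have parts := integral_smul_fderiv_eq_neg_fderiv_smul_of_integrable (μ := volume) (𝕜 := ℝ)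
    (f := φ) (g := W) (v := 1) (by simpa only [fderiv_apply_one_eq_deriv])
    (by simpa only [fderiv_apply_one_eq_deriv] using integrable_smul hW')
    (integrable_smul hW.continuousOn)
    (fun r _ => (hφ.differentiable (by simp)).differentiableAt) (fun r hr => hWd (hφs hr))
  simp only [fderiv_apply_one_eq_deriv] at parts
  simp only [smul_sub]
  rw [integral_sub (integrable_smul hW') (integrable_smul hD), parts, h φ hφ hc hφs, sub_self]

section ParametricIntegral

variable {Y : Type*} [TopologicalSpace Y] [CompactSpace Y] [MeasurableSpace Y]
  [OpensMeasurableSpace Y] {μ : Measure Y} [IsFiniteMeasure μ]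
  {s : Set ℝ} {G G' : ℝ → Y → V}

theorem hasDerivAt_integral_of_continuousOn (hs : IsOpen s) (hG : ∀ r ∈ s, Continuous (G r))
    (hG' : ContinuousOn (Function.uncurry G') (s ×ˢ univ))
    (hderiv : ∀ r ∈ s, ∀ y, HasDerivAt (G · y) (G' r y) r) {r : ℝ} (hr : r ∈ s) :
    HasDerivAt (fun r => ∫ y, G r y ∂μ) (∫ y, G' r y ∂μ) r := by
  have integrable {f : Y → V} (hf : Continuous f) : Integrable f μ :=
    hf.integrable_of_hasCompactSupport (.of_compactSpace f)
  obtain ⟨K, hK, hKr, hKs⟩ := exists_compact_subset hs hr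
  obtain ⟨C, hC⟩ := (hK.prod (isCompact_univ (X := Y))).exists_bound_of_continuousOn
    (hG'.mono (prod_mono hKs subset_rfl))
  refine (hasDerivAt_integral_of_dominated_loc_of_deriv_le (mem_interior_iff_mem_nhds.1 hKr)
    (bound := fun _ => C) ?_ (integrable (hG r hr)) (integrable ?_).aestronglyMeasurable
    (.of_forall fun y x hx => hC (x, y) ⟨hx, mem_univ y⟩) (integrable_const C)
    (.of_forall fun y x hx => hderiv x (hKs hx) y)).2
  · filter_upwards [hs.mem_nhds hr] with x hx using (integrable (hG x hx)).aestronglyMeasurable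
  · exact hG'.comp_continuous (by fun_prop) fun y => ⟨hr, mem_univ y⟩

theorem contDiffOn_one_integral (hs : IsOpen s) (hG : ∀ r ∈ s, Continuous (G r))
    (hG' : ContinuousOn (Function.uncurry G') (s ×ˢ univ))
    (hderiv : ∀ r ∈ s, ∀ y, HasDerivAt (G · y) (G' r y) r) :
    ContDiffOn ℝ 1 (fun r => ∫ y, G r y ∂μ) s := by
  have hasDerivAt {r : ℝ} (hr : r ∈ s) :=
    hasDerivAt_integral_of_continuousOn (μ := μ) hs hG hG' hderiv hr
  have continuousOn_integral : ContinuousOn (fun r => ∫ y, G' r y ∂μ) s :=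
    continuousOn_integral_of_compact_support isCompact_univ hG' (by simp)
  rw [← zero_add (1 : WithTop ℕ∞), contDiffOn_succ_iff_deriv_of_isOpen hs]
  refine ⟨fun r hr => (hasDerivAt hr).differentiableAt.differentiableWithinAt, by simp, ?_⟩
  exact contDiffOn_zero.2 (continuousOn_integral.congr fun r hr => (hasDerivAt hr).deriv)

end ParametricIntegral

end IntegrationByParts

section SphereIntegral

theorem hasCompactSupport_comp_norm {E : Type*} [NormedAddCommGroup E] [ProperSpace E]
    {φ : ℝ → ℝ} (hc : HasCompactSupport φ) : HasCompactSupport (fun x : E => φ ‖x‖) :=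
  (isCompact_preimage_norm hc).of_isClosed_subset (isClosed_tsupport _)
    (tsupport_comp_subset_preimage φ continuous_norm)

theorem hasFDerivAt_comp_norm {E : Type*} [NormedAddCommGroup E] [InnerProductSpace ℝ E]
    {φ : ℝ → ℝ} (hφ : Differentiable ℝ φ) (hφ₀ : tsupport φ ⊆ Ioi 0) (x : E) :
    HasFDerivAt (fun x : E => φ ‖x‖) ((deriv φ ‖x‖ / ‖x‖) • innerSL ℝ x) x := by
  rcases eq_or_ne x 0 with rfl | hx
  · have zero_notMem : (0 : E) ∉ tsupport (fun x : E => φ ‖x‖) := fun h =>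
      (mem_Ioi.1 (hφ₀ (tsupport_comp_subset_preimage φ continuous_norm h))).ne' norm_zero
    simpa using (hasFDerivAt_const (𝕜 := ℝ) (0 : ℝ) (0 : E)).congr_of_eventuallyEq
      (notMem_tsupport_iff_eventuallyEq.1 zero_notMem)
  · have hasFDerivAt_norm : HasFDerivAt (fun x : E => ‖x‖) (‖x‖⁻¹ • innerSL ℝ x) x := by
      have := (hasStrictFDerivAt_norm_sq x).hasFDerivAt.sqrt (by simpa using hx)
      simp only [Real.sqrt_sq (norm_nonneg _)] at this
      refine this.congr_fderiv ?_
      ext v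
      simp only [one_div, mul_inv_rev, _root_.smul_apply, coe_innerSL_apply, nsmul_eq_mul,
        Nat.cast_ofNat, smul_eq_mul]
      ring
    have := (hφ ‖x‖).hasDerivAt.comp_hasFDerivAt x hasFDerivAt_norm
    rwa [smul_smul, ← div_eq_mul_inv] at this

theorem norm_smul_sphere {E : Type*} [NormedAddCommGroup E] [NormedSpace ℝ E] {r : ℝ} (hr : 0 < r)
    (u : Metric.sphere (0 : E) 1) : ‖r • (u : E)‖ = r := by
  rw [norm_smul, norm_eq_of_mem_sphere, mul_one, Real.norm_of_nonneg hr.le]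

theorem comp_homeomorphUnitSphereProd {E V : Type*} [NormedAddCommGroup E] [NormedSpace ℝ E]
    (f : E → V) :
    (fun z : Metric.sphere (0 : E) 1 × Ioi (0 : ℝ) => f ((z.2 : ℝ) • (z.1 : E))) ∘
      homeomorphUnitSphereProd E = f ∘ Subtype.val := by
  ext x
  simp [smul_smul, mul_inv_cancel₀ (norm_ne_zero_iff.2 x.2)]

theorem contDiffOn_inner_div_norm_smul {E V : Type*} [NormedAddCommGroup E]
    [InnerProductSpace ℝ E] [NormedAddCommGroup V] [NormedSpace ℝ V] {n : WithTop ℕ∞} {s : Set ℝ}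
    (hs₀ : s ⊆ Ioi 0) {f : E → V} (hf : ContDiffOn ℝ n f (norm ⁻¹' s)) (v : E) :
    ContDiffOn ℝ n (fun x => (inner ℝ x v / ‖x‖) • f x) (norm ⁻¹' s) := by
  have norm_ne_zero (x : E) (hx : x ∈ norm ⁻¹' s) : ‖x‖ ≠ 0 := (mem_Ioi.1 (hs₀ hx)).ne'
  have contDiffOn_norm : ContDiffOn ℝ n (fun x : E => ‖x‖) (norm ⁻¹' s) :=
    contDiffOn_id.norm ℝ fun x hx => norm_ne_zero_iff.1 (norm_ne_zero x hx)
  exact ((contDiffOn_id.inner ℝ contDiffOn_const).div contDiffOn_norm norm_ne_zero).smul hf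

variable {E V : Type*} [NormedAddCommGroup E] [InnerProductSpace ℝ E] [FiniteDimensional ℝ E]
  [MeasurableSpace E] [BorelSpace E] [NormedAddCommGroup V]

theorem integrable_smul_sphere {f : E → V} (hf : Integrable f) :
    Integrable (fun z : Metric.sphere (0 : E) 1 × Ioi (0 : ℝ) => f ((z.2 : ℝ) • (z.1 : E)))
      ((volume : Measure E).toSphere.prod (.volumeIoiPow (Module.finrank ℝ E - 1))) := by
  rw [← volume.measurePreserving_homeomorphUnitSphereProd.integrable_comp_emb
    (homeomorphUnitSphereProd E).measurableEmbedding, comp_homeomorphUnitSphereProd,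
    ← integrableOn_iff_comap_subtypeVal (measurableSet_singleton _).compl]
  exact hf.integrableOn

theorem integrable_comp_smul_sphere {f : E → V} {r : ℝ} (hr : 0 < r)
    (hf : ContinuousOn f (norm ⁻¹' {r})) :
    Integrable (fun u : Metric.sphere (0 : E) 1 => f (r • (u : E)))
      (volume : Measure E).toSphere :=
  (hf.comp_continuous (by fun_prop) fun u => norm_smul_sphere hr u).integrable_of_hasCompactSupport
    (.of_compactSpace _)

variable [NormedSpace ℝ V]

/-- The integral of a function over the sphere of radius `r > 0` centred at the origin. -/
def sphereIntegral (f : E → V) (r : ℝ) : V :=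
  r ^ (Module.finrank ℝ E - 1) •
    ∫ u : Metric.sphere (0 : E) 1, f (r • (u : E)) ∂(volume : Measure E).toSphere

theorem sphereIntegral_congr {f g : E → V} {r : ℝ} (hr : 0 < r)
    (h : ∀ x, ‖x‖ = r → f x = g x) : sphereIntegral f r = sphereIntegral g r := by
  simp only [sphereIntegral, h _ (norm_smul_sphere hr _)]

theorem sphereIntegral_norm_smul (φ : ℝ → ℝ) (f : E → V) {r : ℝ} (hr : 0 < r) :
    sphereIntegral (fun x => φ ‖x‖ • f x) r = φ r • sphereIntegral f r := by
  simp only [sphereIntegral, norm_smul_sphere hr, integral_smul]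
  rw [smul_comm]

theorem sphereIntegral_const_smul {𝕜 : Type*} [NormedField 𝕜] [NormedSpace 𝕜 V]
    [SMulCommClass ℝ 𝕜 V] (c : 𝕜) (f : E → V) (r : ℝ) :
    sphereIntegral (fun x => c • f x) r = c • sphereIntegral f r := by
  rw [sphereIntegral, integral_smul, smul_comm, sphereIntegral]

theorem sphereIntegral_sub {f g : E → V} {r : ℝ} (hr : 0 < r) (hf : ContinuousOn f (norm ⁻¹' {r}))
    (hg : ContinuousOn g (norm ⁻¹' {r})) :
    sphereIntegral (fun x => f x - g x) r = sphereIntegral f r - sphereIntegral g r := by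
  rw [sphereIntegral, integral_sub (integrable_comp_smul_sphere hr hf)
    (integrable_comp_smul_sphere hr hg), smul_sub, sphereIntegral, sphereIntegral]

theorem sphereIntegral_finsetSum {ι : Type*} (t : Finset ι) {f : ι → E → V} {r : ℝ} (hr : 0 < r)
    (hf : ∀ i ∈ t, ContinuousOn (f i) (norm ⁻¹' {r})) :
    sphereIntegral (fun x => ∑ i ∈ t, f i x) r = ∑ i ∈ t, sphereIntegral (f i) r := by
  rw [sphereIntegral, integral_finsetSum t fun i hi => integrable_comp_smul_sphere hr (hf i hi),
    Finset.smul_sum]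
  rfl

theorem tendsto_sphereIntegral_zero {f : E → V} {l : Filter ℝ} {ρ : ℝ} (hl : l ≤ 𝓝 ρ)
    (hl₀ : ∀ᶠ r in l, 0 < r) (hf : Tendsto f (comap norm l) (𝓝 0)) :
    Tendsto (sphereIntegral f) l (𝓝 0) := by
  have tendsto_pow : Tendsto (· ^ (Module.finrank ℝ E - 1)) l (𝓝 (ρ ^ (Module.finrank ℝ E - 1))) :=
    ((continuous_pow _).tendsto ρ).mono_left hl
  rw [← smul_zero (ρ ^ (Module.finrank ℝ E - 1))]
  refine tendsto_pow.smul ((isLittleO_one_iff ℝ).1 (isLittleO_iff.2 fun c hc => ?_))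
  set μ := (volume : Measure E).toSphere.real univ
  have μ_nonneg : 0 ≤ μ := measureReal_nonneg
  have norm_le : ∀ᶠ x in comap norm l, ‖f x‖ ≤ c / (μ + 1) := by
    filter_upwards [hf.norm.eventually_lt_const (u := c / (μ + 1)) (by rw [norm_zero]; positivity)]
      with x hx using hx.le
  filter_upwards [eventually_comap.1 norm_le, hl₀] with r hr hr₀
  calc _ ≤ c / (μ + 1) * μ :=
        norm_integral_le_of_norm_le_const (.of_forall fun u => hr _ (norm_smul_sphere hr₀ u))
    _ ≤ c * ‖(1 : ℝ)‖ := by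
        rw [norm_one, mul_one, div_mul_eq_mul_div, div_le_iff₀ (by positivity)]
        nlinarith [μ_nonneg]

theorem integral_smul_volumeIoiPow (n : ℕ) (f : ℝ → V) :
    ∫ r : Ioi (0 : ℝ), f r ∂Measure.volumeIoiPow n = ∫ r in Ioi (0 : ℝ), r ^ n • f r := by
  rw [Measure.volumeIoiPow, ← integral_subtype_comap measurableSet_Ioi fun r => r ^ n • f r]
  simp only [ENNReal.ofReal]
  rw [integral_withDensity_eq_integral_smul (by fun_prop)]
  refine integral_congr_ae (.of_forall fun r => ?_)
  simp only [NNReal.smul_def, Real.coe_toNNReal _ (pow_nonneg (mem_Ioi.1 r.2).le n)]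

theorem integrable_volumeIoiPow_iff (n : ℕ) (f : ℝ → V) :
    Integrable (fun r : Ioi (0 : ℝ) => f r) (Measure.volumeIoiPow n) ↔
      IntegrableOn (fun r => r ^ n • f r) (Ioi 0) := by
  rw [Measure.volumeIoiPow, integrableOn_iff_comap_subtypeVal measurableSet_Ioi]
  simp only [ENNReal.ofReal]
  rw [integrable_withDensity_iff_integrable_smul (by fun_prop)]
  refine integrable_congr (.of_forall fun r => ?_)
  simp only [NNReal.smul_def, Function.comp_apply,
    Real.coe_toNNReal _ (pow_nonneg (mem_Ioi.1 r.2).le n)]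

theorem integrableOn_sphereIntegral {f : E → V} (hf : Integrable f) :
    IntegrableOn (sphereIntegral f) (Ioi 0) :=
  (integrable_volumeIoiPow_iff _ fun r => ∫ u : Metric.sphere (0 : E) 1, f (r • (u : E))
    ∂(volume : Measure E).toSphere).1 (integrable_smul_sphere hf).integral_prod_right

theorem integral_eq_integral_sphereIntegral [Nontrivial E] {f : E → V} (hf : Integrable f) :
    ∫ x, f x = ∫ r in Ioi (0 : ℝ), sphereIntegral f r := by
  calc ∫ x, f x = ∫ x, (f ∘ Subtype.val) x ∂volume.comap (Subtype.val : ({0}ᶜ : Set E) → E) := by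
        simp only [Function.comp_apply]
        rw [integral_subtype_comap (measurableSet_singleton _).compl f, restrict_compl_singleton]
    _ = ∫ z, f ((z.2 : ℝ) • (z.1 : E)) ∂((volume : Measure E).toSphere.prod
          (.volumeIoiPow (Module.finrank ℝ E - 1))) := by
        rw [← comp_homeomorphUnitSphereProd,
          ← volume.measurePreserving_homeomorphUnitSphereProd.integral_comp
            (homeomorphUnitSphereProd E).measurableEmbedding]
        rfl
    _ = ∫ r in Ioi (0 : ℝ), sphereIntegral f r := by
        rw [integral_prod_symm _ (integrable_smul_sphere hf)]
        exact integral_smul_volumeIoiPow _ fun r => ∫ u : Metric.sphere (0 : E) 1,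
          f (r • (u : E)) ∂(volume : Measure E).toSphere

variable {s : Set ℝ} {f : E → V}

theorem sphereIntegral_indicator_preimage_norm {r : ℝ} (hr : 0 < r) :
    sphereIntegral ((norm ⁻¹' s).indicator f) r = s.indicator (sphereIntegral f) r := by
  have indicator_eq : (norm ⁻¹' s).indicator f = fun x => s.indicator (1 : ℝ → ℝ) ‖x‖ • f x := by
    ext x
    by_cases hx : ‖x‖ ∈ s <;> simp [hx]
  rw [indicator_eq, sphereIntegral_norm_smul _ _ hr]
  by_cases hr : r ∈ s <;> simp [hr]

theorem integrableOn_sphereIntegral_of_preimage_norm (hs : MeasurableSet s) (hs₀ : s ⊆ Ioi 0)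
    (hf : IntegrableOn f (norm ⁻¹' s)) : IntegrableOn (sphereIntegral f) s :=
  ((integrableOn_sphereIntegral ((integrable_indicator_iff (measurable_norm hs)).2 hf)).mono_set
    hs₀).congr_fun (fun r hr => by
      rw [sphereIntegral_indicator_preimage_norm (hs₀ hr), indicator_of_mem hr]) hs

theorem setIntegral_preimage_norm [Nontrivial E] (hs : MeasurableSet s) (hs₀ : s ⊆ Ioi 0)
    (hf : IntegrableOn f (norm ⁻¹' s)) :
    ∫ x in norm ⁻¹' s, f x = ∫ r in s, sphereIntegral f r := by
  rw [← integral_indicator (measurable_norm hs),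
    integral_eq_integral_sphereIntegral ((integrable_indicator_iff (measurable_norm hs)).2 hf),
    setIntegral_congr_fun measurableSet_Ioi fun r => sphereIntegral_indicator_preimage_norm,
    setIntegral_indicator hs, inter_eq_self_of_subset_right hs₀]

theorem contDiffOn_sphereIntegral (hs : IsOpen s) (hs₀ : s ⊆ Ioi 0)
    (hf : ContDiffOn ℝ 1 f (norm ⁻¹' s)) : ContDiffOn ℝ 1 (sphereIntegral f) s := by
  have isOpen_shell : IsOpen (norm ⁻¹' s : Set E) := hs.preimage continuous_norm
  have smul_mem {r : ℝ} (hr : r ∈ s) (u : Metric.sphere (0 : E) 1) :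
      r • (u : E) ∈ norm ⁻¹' s := by
    rwa [mem_preimage, norm_smul_sphere (hs₀ hr)]
  refine (contDiff_id.pow _).contDiffOn.smul (contDiffOn_one_integral hs
    (G' := fun r u => fderiv ℝ f (r • (u : E)) u) (fun r hr => ?_) ?_ fun r hr u => ?_)
  · exact hf.continuousOn.comp_continuous (by fun_prop) (smul_mem hr)
  · refine ((hf.continuousOn_fderiv_of_isOpen isOpen_shell le_rfl).comp
      (f := fun z : ℝ × Metric.sphere (0 : E) 1 => z.1 • (z.2 : E)) (by fun_prop)
      fun z hz => smul_mem hz.1 z.2).clm_apply (by fun_prop)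
  · have hasFDerivAt := ((hf.contDiffAt (isOpen_shell.mem_nhds (smul_mem hr u))).differentiableAt
      one_ne_zero).hasFDerivAt
    exact hasFDerivAt.comp_hasDerivAt r (by simpa using (hasDerivAt_id r).smul_const (u : E))

theorem continuousOn_sphereIntegral (hs₀ : s ⊆ Ioi 0) (hf : ContinuousOn f (norm ⁻¹' s)) :
    ContinuousOn (sphereIntegral f) s := by
  refine (continuous_id.pow _).continuousOn.smul (continuousOn_integral_of_compact_support
    isCompact_univ ?_ (by simp))
  refine hf.comp (f := fun z : ℝ × Metric.sphere (0 : E) 1 => z.1 • (z.2 : E)) (by fun_prop)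
    fun z hz => ?_
  rw [mem_preimage, norm_smul_sphere (hs₀ hz.1)]
  exact hz.1

theorem integrable_norm_smul (hs : IsOpen s) {φ : ℝ → ℝ} (hφ : Continuous φ)
    (hc : HasCompactSupport φ) (hφs : tsupport φ ⊆ s) (hf : ContinuousOn f (norm ⁻¹' s)) :
    Integrable fun x => φ ‖x‖ • f x := by
  have isOpen_shell : IsOpen (norm ⁻¹' s : Set E) := hs.preimage continuous_norm
  have tsupport_subset : tsupport (fun x : E => φ ‖x‖) ⊆ norm ⁻¹' s :=
    (tsupport_comp_subset_preimage φ continuous_norm).trans (preimage_mono hφs)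
  have continuous_comp : Continuous fun x : E => φ ‖x‖ := hφ.comp continuous_norm
  exact integrable_smul_of_tsupport_subset isOpen_shell continuous_comp
    (hasCompactSupport_comp_norm hc) tsupport_subset hf

theorem integral_norm_smul [Nontrivial E] {φ : ℝ → ℝ} (hφ₀ : tsupport φ ⊆ Ioi 0)
    (hf : Integrable fun x => φ ‖x‖ • f x) :
    ∫ x, φ ‖x‖ • f x = ∫ r, φ r • sphereIntegral f r := by
  rw [integral_eq_integral_sphereIntegral hf,
    setIntegral_congr_fun measurableSet_Ioi fun r hr => sphereIntegral_norm_smul φ f hr]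
  refine setIntegral_eq_integral_of_forall_compl_eq_zero fun r hr => ?_
  rw [image_eq_zero_of_notMem_tsupport fun h => hr (hφ₀ h), zero_smul]

theorem integral_smul_sphereIntegral_fderiv [Nontrivial E] (hs : IsOpen s) (hs₀ : s ⊆ Ioi 0)
    (hf : ContDiffOn ℝ 1 f (norm ⁻¹' s)) (v : E) {φ : ℝ → ℝ} (hφ : ContDiff ℝ ∞ φ)
    (hc : HasCompactSupport φ) (hφs : tsupport φ ⊆ s) :
    ∫ r, φ r • sphereIntegral (fun x => fderiv ℝ f x v) r =
      -∫ r, deriv φ r • sphereIntegral (fun x => (inner ℝ x v / ‖x‖) • f x) r := by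
  have isOpen_shell : IsOpen (norm ⁻¹' s : Set E) := hs.preimage continuous_norm
  have hφ's : tsupport (deriv φ) ⊆ s := tsupport_deriv_subset.trans hφs
  have continuousOn_fderiv : ContinuousOn (fun x => fderiv ℝ f x v) (norm ⁻¹' s) :=
    (hf.continuousOn_fderiv_of_isOpen isOpen_shell le_rfl).clm_apply continuousOn_const
  have fderiv_integrable := integrable_norm_smul hs hφ.continuous hc hφs continuousOn_fderiv
  have inner_integrable := integrable_norm_smul hs (hφ.continuous_deriv (by simp)) hc.deriv hφ's
    (contDiffOn_inner_div_norm_smul hs₀ hf v).continuousOn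
  have hasFDerivAt (x : E) :=
    hasFDerivAt_comp_norm (hφ.differentiable (by simp)) (hφs.trans hs₀) x
  have fderiv_smul : (fun x => fderiv ℝ (fun x : E => φ ‖x‖) x v • f x) =
      fun x => deriv φ ‖x‖ • (inner ℝ x v / ‖x‖) • f x := by
    ext x
    simp only [(hasFDerivAt x).fderiv, _root_.smul_apply, innerSL_apply_apply, smul_eq_mul,
      smul_smul, div_mul_eq_mul_div, mul_div_assoc]
  rw [← integral_norm_smul (hφs.trans hs₀) fderiv_integrable,
    ← integral_norm_smul (hφ's.trans hs₀) inner_integrable, ← fderiv_smul]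
  exact integral_smul_fderiv_eq_neg_fderiv_smul_of_integrable (fderiv_smul ▸ inner_integrable)
    fderiv_integrable (integrable_norm_smul hs hφ.continuous hc hφs hf.continuousOn)
    (fun x _ => (hasFDerivAt x).differentiableAt) fun x hx => (hf.contDiffAt (isOpen_shell.mem_nhds
      (hφs (tsupport_comp_subset_preimage φ continuous_norm hx)))).differentiableAt one_ne_zero

/-- The divergence theorem in polar coordinates, for the vector field `f • v`. -/
theorem hasDerivAt_sphereIntegral [CompleteSpace V] [Nontrivial E] (hs : IsOpen s) (hs₀ : s ⊆ Ioi 0)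
    (hf : ContDiffOn ℝ 1 f (norm ⁻¹' s)) (v : E) {r : ℝ} (hr : r ∈ s) :
    HasDerivAt (sphereIntegral fun x => (inner ℝ x v / ‖x‖) • f x)
      (sphereIntegral (fun x => fderiv ℝ f x v) r) r :=
  hasDerivAt_of_integral_smul_eq hs
    (contDiffOn_sphereIntegral hs hs₀ (contDiffOn_inner_div_norm_smul hs₀ hf v))
    (continuousOn_sphereIntegral hs₀ ((hf.continuousOn_fderiv_of_isOpen
      (hs.preimage continuous_norm) le_rfl).clm_apply continuousOn_const))
    (fun _ => integral_smul_sphereIntegral_fderiv hs hs₀ hf v) hr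

end SphereIntegral

/-- The components of the vector field dual to the three-form `β`. -/
def dualField (β : Form 3) (j : Fin 4) (x : E4) : ℂ :=
  (-1) ^ (j : ℕ) * β x (fun k => stdB (j.succAbove k))

/-- The component, normal to the sphere through `x`, of the vector field dual to `β`. -/
def normalComponent (β : Form 3) (x : E4) : ℂ :=
  ∑ j, (inner ℝ x (stdB j) / ‖x‖) • dualField β j x

theorem sliceIntegral_eq_sphereIntegral {r : ℝ} (hr : 0 < r) (β : Form 3) :
    sliceIntegral r β = sphereIntegral (normalComponent β) r := by
  have inner_div (u : Metric.sphere (0 : E4) 1) (j : Fin 4) :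
      inner ℝ (r • (u : E4)) (stdB j) / r = (u : E4) j := by
    simp [stdB, EuclideanSpace.inner_single_right, hr.ne']
  simp only [sliceIntegral, sphereIntegral, normalComponent, dualField, norm_smul_sphere hr,
    inner_div, integral_const_mul, finrank_euclideanSpace_fin, Complex.real_smul]
  congr! 4
  ring

theorem contDiffOn_dualField {k : WithTop ℕ∞} {s : Set E4} {β : Form 3} (hβ : ContDiffOn ℝ k β s)
    (j : Fin 4) : ContDiffOn ℝ k (dualField β j) s :=
  contDiffOn_const.mul ((ContinuousAlternatingMap.apply ℝ E4 ℂ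
    (fun k => stdB (j.succAbove k))).contDiff.comp_contDiffOn hβ)

theorem topCoeff_extDeriv {β : Form 3} {x : E4} (hβ : DifferentiableAt ℝ β x) :
    topCoeff (extDeriv β x) = ∑ j, fderiv ℝ (dualField β j) x (stdB j) := by
  rw [topCoeff, extDeriv_apply hβ]
  refine Finset.sum_congr rfl fun j _ => ?_
  have differentiableAt_apply : DifferentiableAt ℝ (fun y => β y (j.removeNth stdB)) x :=
    (ContinuousAlternatingMap.apply ℝ E4 ℂ (j.removeNth stdB)).differentiableAt.comp x hβ
  change _ = fderiv ℝ (fun y => ((-1) ^ (j : ℕ) : ℂ) * β y (j.removeNth stdB)) x (stdB j)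
  rw [fderiv_const_mul differentiableAt_apply]
  simp

theorem Ioo_one_two_subset_Ioi : Ioo (1 : ℝ) 2 ⊆ Ioi 0 := fun _ hr => one_pos.trans hr.1

theorem preimage_norm_singleton_subset_M {r : ℝ} (hr : r ∈ Ioo (1 : ℝ) 2) :
    (norm ⁻¹' {r} : Set E4) ⊆ M :=
  preimage_mono (t := Ioo 1 2) (singleton_subset_iff.2 hr)

theorem contDiffOn_inner_div_norm_smul_dualField {β : Form 3} (hβ : ContDiffOn ℝ ∞ β M)
    (j : Fin 4) : ContDiffOn ℝ ∞ (fun x => (inner ℝ x (stdB j) / ‖x‖) • dualField β j x) M :=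
  contDiffOn_inner_div_norm_smul Ioo_one_two_subset_Ioi (contDiffOn_dualField hβ j) _

theorem hasDerivAt_sliceIntegral {β : Form 3} (hβ : ContDiffOn ℝ ∞ β M) {r : ℝ}
    (hr : r ∈ Ioo (1 : ℝ) 2) : HasDerivAt (fun r => sliceIntegral r β)
      (sphereIntegral (fun x => topCoeff (extDeriv β x)) r) r := by
  have smooth_dualField (j) := contDiffOn_dualField hβ j
  have continuousOn_fderiv (j) : ContinuousOn (fun x => fderiv ℝ (dualField β j) x (stdB j)) M :=
    ((smooth_dualField j).continuousOn_fderiv_of_isOpen isOpen_M (by simp)).clm_apply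
      continuousOn_const
  have eventually_eq : (fun r => sliceIntegral r β) =ᶠ[𝓝 r] fun r =>
      ∑ j, sphereIntegral (fun x => (inner ℝ x (stdB j) / ‖x‖) • dualField β j x) r := by
    filter_upwards [isOpen_Ioo.mem_nhds hr] with s hs
    rw [sliceIntegral_eq_sphereIntegral (one_pos.trans hs.1)]
    exact sphereIntegral_finsetSum _ (one_pos.trans hs.1) fun j _ =>
      (contDiffOn_inner_div_norm_smul_dualField hβ j).continuousOn.mono
        (preimage_norm_singleton_subset_M hs)
  have deriv_eq : sphereIntegral (fun x => topCoeff (extDeriv β x)) r =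
      ∑ j, sphereIntegral (fun x => fderiv ℝ (dualField β j) x (stdB j)) r := by
    rw [← sphereIntegral_finsetSum _ (one_pos.trans hr.1) fun j _ =>
      (continuousOn_fderiv j).mono (preimage_norm_singleton_subset_M hr)]
    exact sphereIntegral_congr (one_pos.trans hr.1) fun x hx => topCoeff_extDeriv
      (differentiableAt_of_contDiffOn_M hβ (preimage_norm_singleton_subset_M hr hx))
  rw [deriv_eq]
  refine HasDerivAt.congr_of_eventuallyEq (HasDerivAt.fun_sum fun j _ => ?_) eventually_eq
  exact hasDerivAt_sphereIntegral isOpen_Ioo Ioo_one_two_subset_Ioi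
    ((smooth_dualField j).of_le (by simp)) (stdB j) hr

theorem sliceIntegral_congr {β β' : Form 3} {r : ℝ} (hr : 0 < r)
    (h : ∀ x, ‖x‖ = r → β x = β' x) : sliceIntegral r β = sliceIntegral r β' := by
  simp only [sliceIntegral, h _ (norm_smul_sphere hr _)]

theorem sliceIntegral_zero (r : ℝ) : sliceIntegral r 0 = 0 := by
  simp [sliceIntegral]

theorem sliceIntegral_sub {β β' : Form 3} (hβ : ContDiffOn ℝ ∞ β M) (hβ' : ContDiffOn ℝ ∞ β' M)
    {r : ℝ} (hr : r ∈ Ioo (1 : ℝ) 2) :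
    sliceIntegral r (fun x => β x - β' x) = sliceIntegral r β - sliceIntegral r β' := by
  have continuousOn_normalComponent {β : Form 3} (hβ : ContDiffOn ℝ ∞ β M) :
      ContinuousOn (normalComponent β) (norm ⁻¹' {r}) :=
    (ContDiffOn.sum fun j _ =>
      contDiffOn_inner_div_norm_smul_dualField hβ j).continuousOn.mono
        (preimage_norm_singleton_subset_M hr)
  have hr₀ : 0 < r := one_pos.trans hr.1
  simp only [sliceIntegral_eq_sphereIntegral hr₀]
  rw [← sphereIntegral_sub hr₀ (continuousOn_normalComponent hβ) (continuousOn_normalComponent hβ')]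
  refine sphereIntegral_congr hr₀ fun x _ => ?_
  simp only [normalComponent, dualField, ContinuousAlternatingMap.sub_apply, mul_sub, smul_sub,
    Finset.sum_sub_distrib]

theorem sliceIntegral_smul (c : ℂ) (β : Form 3) (r : ℝ) :
    sliceIntegral r (fun x => c • β x) = c * sliceIntegral r β := by
  simp only [sliceIntegral, ← integral_const_mul, ContinuousAlternatingMap.smul_apply, smul_eq_mul,
    Finset.mul_sum]
  congr! 3
  ring

theorem sliceIntegral_extDeriv_eq {α : Form 2} (hα : ContDiffOn ℝ ∞ α M) {r s : ℝ}
    (hr : r ∈ Ioo (1 : ℝ) 2) (hs : s ∈ Ioo (1 : ℝ) 2) :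
    sliceIntegral r (extDeriv α) = sliceIntegral s (extDeriv α) := by
  have hasDerivAt {r : ℝ} (hr : r ∈ Ioo (1 : ℝ) 2) :
      HasDerivAt (fun r => sliceIntegral r (extDeriv α)) 0 r := by
    convert hasDerivAt_sliceIntegral (contDiffOn_extDeriv isOpen_M hα) hr
    rw [sphereIntegral_congr (g := 0) (one_pos.trans hr.1)]
    · simp [sphereIntegral]
    · intro x hx
      rw [extDeriv_extDeriv_eq_zero (hα.contDiffAt (isOpen_M.mem_nhds
        (preimage_norm_singleton_subset_M hr hx)))]
      rfl
  exact isOpen_Ioo.is_const_of_deriv_eq_zero isPreconnected_Ioo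
    (fun r hr => (hasDerivAt hr).differentiableAt.differentiableWithinAt)
    (fun r hr => (hasDerivAt hr).deriv) hr hs

open Manifold in
theorem exists_contDiff_eventuallyEq_zero_one {r s : ℝ} (hrs : r ≠ s) :
    ∃ χ : E4 → ℝ, ContDiff ℝ ∞ χ ∧ (∀ x, ‖x‖ = r → χ =ᶠ[𝓝 x] 0) ∧ ∀ x, ‖x‖ = s → χ =ᶠ[𝓝 x] 1 := by
  have isClosed_sphere (r : ℝ) : IsClosed (norm ⁻¹' {r} : Set E4) :=
    isClosed_singleton.preimage continuous_norm
  obtain ⟨χ, χ_zero, χ_one, -⟩ := exists_contMDiffMap_zero_one_nhds_of_isClosed (n := ⊤) 𝓘(ℝ, E4)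
    (isClosed_sphere r) (isClosed_sphere s) (Disjoint.preimage _ (disjoint_singleton.2 hrs))
  exact ⟨χ, χ.contMDiff.contDiff,
    fun x hx => χ_zero.filter_mono (nhds_le_nhdsSet (mem_preimage.2 hx)),
    fun x hx => χ_one.filter_mono (nhds_le_nhdsSet (mem_preimage.2 hx))⟩

theorem sliceIntegral_extDeriv_eq_zero {α : Form 2} (hα : ContDiffOn ℝ ∞ α M) {r : ℝ}
    (hr : r ∈ Ioo (1 : ℝ) 2) : sliceIntegral r (extDeriv α) = 0 := by
  obtain ⟨s, hs, hsr⟩ := exists_between hr.1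
  have hs' : s ∈ Ioo (1 : ℝ) 2 := ⟨hs, hsr.trans hr.2⟩
  obtain ⟨χ, hχ, χ_zero, χ_one⟩ := exists_contDiff_eventuallyEq_zero_one hsr.ne
  have hχα : ContDiffOn ℝ ∞ (fun x => χ x • α x) M := hχ.contDiffOn.smul hα
  calc sliceIntegral r (extDeriv α) = sliceIntegral r (extDeriv fun x => χ x • α x) := by
        refine sliceIntegral_congr (one_pos.trans hr.1) fun x hx => EventuallyEq.extDeriv_eq ?_
        filter_upwards [χ_one x hx] with y hy
        rw [hy, Pi.one_apply, one_smul]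
    _ = sliceIntegral s (extDeriv fun x => χ x • α x) := sliceIntegral_extDeriv_eq hχα hr hs'
    _ = sliceIntegral s 0 := by
        refine sliceIntegral_congr (one_pos.trans hs) fun x hx => ?_
        have eventually_zero : (fun x => χ x • α x) =ᶠ[𝓝 x] fun x => (0 : ℝ) • α x := by
          filter_upwards [χ_zero x hx] with y hy
          rw [hy, Pi.zero_apply]
        exact eventually_zero.extDeriv_eq.trans
          ((extDeriv_fun_smul 0 α).trans (zero_smul ℝ (extDeriv α x)))
    _ = 0 := sliceIntegral_zero s

theorem norm_normalComponent_le (β : Form 3) (x : E4) : ‖normalComponent β x‖ ≤ 4 * ‖β x‖ := by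
  have norm_stdB (j : Fin 4) : ‖stdB j‖ = 1 := by simp [stdB]
  have norm_term_le (j : Fin 4) : ‖(inner ℝ x (stdB j) / ‖x‖) • dualField β j x‖ ≤ ‖β x‖ := by
    have norm_inner_div_le : ‖inner ℝ x (stdB j) / ‖x‖‖ ≤ 1 := by
      rw [norm_div, norm_norm]
      exact div_le_one_of_le₀ (by simpa [norm_stdB] using norm_inner_le_norm (𝕜 := ℝ) x (stdB j))
        (norm_nonneg x)
    have norm_dualField_le : ‖dualField β j x‖ ≤ ‖β x‖ := by
      simpa [dualField, norm_stdB] using (β x).le_opNorm fun k => stdB (j.succAbove k)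
    rw [norm_smul]
    exact (mul_le_mul norm_inner_div_le norm_dualField_le (norm_nonneg _) zero_le_one).trans_eq
      (one_mul _)
  exact (norm_sum_le_of_le _ fun j _ => norm_term_le j).trans_eq (by simp)

theorem tendsto_sliceIntegral_zero {β : Form 3} {ρ : ℝ} (hβ : Tendsto β (nhdsScri ρ) (𝓝 0)) :
    Tendsto (fun r => sliceIntegral r β) (𝓝[Ioo 1 2] ρ) (𝓝 0) := by
  have eventually_pos : ∀ᶠ r in 𝓝[Ioo 1 2] ρ, 0 < r :=
    eventually_mem_nhdsWithin.mono Ioo_one_two_subset_Ioi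
  have normalComponent_tendsto : Tendsto (normalComponent β) (nhdsScri ρ) (𝓝 0) :=
    squeeze_zero_norm (norm_normalComponent_le β) (by simpa using hβ.norm.const_mul 4)
  refine (tendsto_sphereIntegral_zero nhdsWithin_le_nhds eventually_pos
    normalComponent_tendsto).congr' ?_
  filter_upwards [eventually_pos] with r hr using (sliceIntegral_eq_sphereIntegral hr β).symm

theorem eq_integral_of_tendsto_zero {V : Type*} [NormedAddCommGroup V] [NormedSpace ℝ V]
    [CompleteSpace V] {F g : ℝ → V} {a b ρ r : ℝ} (hg : IntervalIntegrable g volume a b)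
    (hF : ∀ s ∈ Ioo a b, HasDerivAt F (g s) s) (hρ : ρ = a ∨ ρ = b)
    (hlim : Tendsto F (𝓝[Ioo a b] ρ) (𝓝 0)) (hr : r ∈ Ioo a b) : F r = ∫ s in ρ..r, g s := by
  have hab : a < b := hr.1.trans hr.2
  have hr' : r ∈ uIcc a b := Icc_subset_uIcc (Ioo_subset_Icc_self hr)
  have tendsto_F : Tendsto F (𝓝 r) (𝓝 (F r)) := (hF r hr).continuousAt
  rcases hρ with rfl | rfl
  · rw [nhdsWithin_Ioo_eq_nhdsGT hab] at hlim
    rw [intervalIntegral.integral_eq_sub_of_hasDerivAt_of_tendsto hr.1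
      (fun s hs => hF s ⟨hs.1, hs.2.trans hr.2⟩)
      (hg.mono_set (uIcc_subset_uIcc left_mem_uIcc hr')) hlim
      (tendsto_F.mono_left nhdsWithin_le_nhds), sub_zero]
  · rw [nhdsWithin_Ioo_eq_nhdsLT hab] at hlim
    rw [intervalIntegral.integral_symm, intervalIntegral.integral_eq_sub_of_hasDerivAt_of_tendsto
      hr.2 (fun s hs => hF s ⟨hr.1.trans hs.1, hs.2⟩)
      (hg.mono_set (uIcc_subset_uIcc hr' right_mem_uIcc)) (tendsto_F.mono_left nhdsWithin_le_nhds)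
      hlim, zero_sub, neg_neg]

theorem intervalIntegrable_sphereIntegral {f : E4 → ℂ} (hf : IntegrableOn f M) :
    IntervalIntegrable (sphereIntegral f) volume 1 2 :=
  (intervalIntegrable_iff_integrableOn_Ioo_of_le one_le_two).2
    (integrableOn_sphereIntegral_of_preimage_norm measurableSet_Ioo Ioo_one_two_subset_Ioi hf)

theorem integral_M_eq_integral_sphereIntegral {f : E4 → ℂ} (hf : IntegrableOn f M) :
    ∫ x in M, f x = ∫ r in (1 : ℝ)..2, sphereIntegral f r := by
  rw [intervalIntegral.integral_of_le one_le_two, integral_Ioc_eq_integral_Ioo]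
  exact setIntegral_preimage_norm measurableSet_Ioo Ioo_one_two_subset_Ioi hf

section
variable {Λ : ℝ} {S : SForm 2} {Γ : SForm 1} {Ω : E4 → ℝ} {h h' : Perturbation}

theorem cgDensity_comm (hh : IsScatteringState Λ S Γ Ω h) (hh' : IsScatteringState Λ S Γ Ω h') :
    cgDensity S h h' = cgDensity S h' h := by
  ext x
  rw [cgDensity, cgDensity, contract4_eq (hh.symm_ψ x) (hh'.symm_ψ x),
    contract4_eq (hh'.symm_ψ x) (hh.symm_ψ x)]
  ring

theorem hasDerivAt_sliceIntegral_current (hbg : IsSelfDualBackground Λ S Γ)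
    (hh : IsScatteringState Λ S Γ Ω h) (hh' : IsScatteringState Λ S Γ Ω h') {r : ℝ}
    (hr : r ∈ Ioo (1 : ℝ) 2) : HasDerivAt (fun r => sliceIntegral r (current S h h'))
      ((2 : ℂ) • sphereIntegral (cgDensity S h h') r) r := by
  refine (hasDerivAt_sliceIntegral (contDiffOn_current hbg hh hh') hr).congr_deriv ?_
  rw [← sphereIntegral_const_smul]
  exact sphereIntegral_congr (one_pos.trans hr.1) fun x hx =>
    topCoeff_extDeriv_current hbg hh hh' (preimage_norm_singleton_subset_M hr hx)

theorem sliceIntegral_current (hbg : IsSelfDualBackground Λ S Γ)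
    (hΩ : IsConformalCompactification Ω S) (hh : IsScatteringState Λ S Γ Ω h)
    (hh' : IsScatteringState Λ S Γ Ω h') {ρ : ℝ} (hρ : ρ = 1 ∨ ρ = 2)
    (hσ : ∀ A B, ExtendsSmoothly (h.σ A B) M (M ∪ scri ρ)) {r : ℝ} (hr : r ∈ Ioo (1 : ℝ) 2) :
    sliceIntegral r (current S h h') =
      2 * ∫ s in ρ..r, sphereIntegral (cgDensity S h h') s := by
  have intervalIntegrable :=
    intervalIntegrable_sphereIntegral (integrableOn_cgDensity hbg hΩ hh hh')
  rw [← intervalIntegral.integral_const_mul]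
  exact eq_integral_of_tendsto_zero (intervalIntegrable.const_mul 2)
    (fun s hs => hasDerivAt_sliceIntegral_current hbg hh hh' hs) hρ
    (tendsto_sliceIntegral_zero (tendsto_current_zero hbg hΩ hh hh' hρ hσ)) hr

theorem sliceIntegral_current_sub_current (hbg : IsSelfDualBackground Λ S Γ)
    (hh : IsScatteringState Λ S Γ Ω h) (hh' : IsScatteringState Λ S Γ Ω h') {r : ℝ}
    (hr : r ∈ Ioo (1 : ℝ) 2) :
    sliceIntegral r (current S h' h) - sliceIntegral r (current S h h') =
      -(((Λ / 3 : ℝ) : ℂ) * sliceIntegral r (symplecticCurrent h h')) := by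
  have contDiffOn_contract_γ : ContDiffOn ℝ ∞ (contract (n := 2) rfl h.γ (lower h'.γ)) M :=
    contDiffOn_contract rfl hh.smooth_γ (contDiffOn_lower hh'.smooth_γ)
  have contDiffOn_smul : ContDiffOn ℝ ∞
      (fun x => ((Λ / 3 : ℝ) : ℂ) • symplecticCurrent h h' x) M :=
    ContDiffOn.smul (f := fun _ => ((Λ / 3 : ℝ) : ℂ)) contDiffOn_const
      (contDiffOn_symplecticCurrent hh hh')
  rw [← sliceIntegral_sub (contDiffOn_current hbg hh' hh) (contDiffOn_current hbg hh hh') hr,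
    sliceIntegral_congr (one_pos.trans hr.1) fun x hx =>
      current_sub_current hbg hh hh' (preimage_norm_singleton_subset_M hr hx),
    sliceIntegral_sub (contDiffOn_extDeriv isOpen_M contDiffOn_contract_γ) contDiffOn_smul hr,
    sliceIntegral_extDeriv_eq_zero contDiffOn_contract_γ hr, sliceIntegral_smul, zero_sub]

theorem sliceIntegral_symplecticCurrent (hΛ : Λ ≠ 0) (hbg : IsSelfDualBackground Λ S Γ)
    (hΩ : IsConformalCompactification Ω S) (hh : IsScatteringState Λ S Γ Ω h)
    (hh' : IsScatteringState Λ S Γ Ω h')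
    (hσ : ∀ A B, ExtendsSmoothly (h.σ A B) M (M ∪ scri 1))
    (hσ' : ∀ A B, ExtendsSmoothly (h'.σ A B) M (M ∪ scri 2)) {r : ℝ} (hr : r ∈ Ioo (1 : ℝ) 2) :
    sliceIntegral r (symplecticCurrent h h') = 6 / (Λ : ℂ) * ∫ x in M, cgDensity S h h' x := by
  have integrableOn := integrableOn_cgDensity hbg hΩ hh hh'
  have intervalIntegrable := intervalIntegrable_sphereIntegral integrableOn
  have hr' : r ∈ uIcc (1 : ℝ) 2 := Icc_subset_uIcc (Ioo_subset_Icc_self hr)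
  have flux_from_past := sliceIntegral_current hbg hΩ hh hh' (.inl rfl) hσ hr
  have flux_from_future := sliceIntegral_current hbg hΩ hh' hh (.inr rfl) hσ' hr
  rw [cgDensity_comm hh' hh, intervalIntegral.integral_symm] at flux_from_future
  have flux_sub_flux := sliceIntegral_current_sub_current hbg hh hh' hr
  rw [flux_from_past, flux_from_future] at flux_sub_flux
  rw [integral_M_eq_integral_sphereIntegral integrableOn,
    ← intervalIntegral.integral_add_adjacent_intervals
      (intervalIntegrable.mono_set (uIcc_subset_uIcc left_mem_uIcc hr'))
      (intervalIntegrable.mono_set (uIcc_subset_uIcc hr' right_mem_uIcc))]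
  have hΛ' : (Λ : ℂ) ≠ 0 := Complex.ofReal_ne_zero.2 hΛ
  push_cast at flux_sub_flux
  field_simp
  linear_combination 3 * flux_sub_flux

end

end MHV

end

theorem mainTheorem4_general (Λ κ ε : ℝ) (hΛ : Λ ≠ 0) (hκ : κ ≠ 0) (hε : ε ≠ 0)
    (S : MHV.SForm 2) (Γ : MHV.SForm 1) (Ω : MHV.E4 → ℝ)
    (hbg : MHV.IsSelfDualBackground Λ S Γ)
    (hΩ : MHV.IsConformalCompactification Ω S)
    (h₁ h₂ : MHV.Perturbation)
    (hh₁ : MHV.IsScatteringState Λ S Γ Ω h₁)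
    (hh₂ : MHV.IsScatteringState Λ S Γ Ω h₂)
    (hσ₁ : ∀ A B, MHV.ExtendsSmoothly (h₁.σ A B) MHV.M (MHV.M ∪ MHV.scri 1))
    (hσ₂ : ∀ A B, MHV.ExtendsSmoothly (h₂.σ A B) MHV.M (MHV.M ∪ MHV.scri 2)) :
    MeasureTheory.IntegrableOn (MHV.cgDensity S h₁ h₂) MHV.M ∧
    ∀ r ∈ Set.Ioo (1 : ℝ) 2,
      MHV.IGR κ r h₁ h₂ =
        -(3 * (ε : ℂ) ^ 2 / ((Λ : ℂ) * (κ : ℂ) ^ 2)) * MHV.ICG ε S h₁ h₂ := by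
  refine ⟨MHV.integrableOn_cgDensity hbg hΩ hh₁ hh₂, fun r hr => ?_⟩
  have hΛ' : (Λ : ℂ) ≠ 0 := Complex.ofReal_ne_zero.2 hΛ
  have hκ' : (κ : ℂ) ≠ 0 := Complex.ofReal_ne_zero.2 hκ
  have hε' : (ε : ℂ) ≠ 0 := Complex.ofReal_ne_zero.2 hε
  have symplectic_flux := MHV.sliceIntegral_symplecticCurrent hΛ hbg hΩ hh₁ hh₂ hσ₁ hσ₂ hr
  unfold MHV.symplecticCurrent at symplectic_flux
  rw [MHV.IGR, MHV.innerProduct, MHV.ICG, symplectic_flux]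
  field_simp
  ring

theorem mainTheorem4 (Λ κ ε : ℝ) (hΛ : Λ ≠ 0) (hκ : κ ≠ 0) (hε : ε ≠ 0)
    (S : MHV.SForm 2) (Γ : MHV.SForm 1) (Ω : MHV.E4 → ℝ)
    (hbg : MHV.IsSelfDualBackground Λ S Γ)
    (hΩ : MHV.IsConformalCompactification Ω S)
    (h₁ h₂ : MHV.Perturbation)
    (hh₁ : MHV.IsScatteringState Λ S Γ Ω h₁)
    (hh₂ : MHV.IsScatteringState Λ S Γ Ω h₂)
    (hasd₁ : MHV.IsASDAt 1 h₁) (hasd₂ : MHV.IsASDAt 2 h₂) :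
    MeasureTheory.IntegrableOn (MHV.cgDensity S h₁ h₂) MHV.M ∧
    ∀ r ∈ Set.Ioo (1 : ℝ) 2,
      MHV.IGR κ r h₁ h₂ =
        -(3 * (ε : ℂ) ^ 2 / ((Λ : ℂ) * (κ : ℂ) ^ 2)) * MHV.ICG ε S h₁ h₂ :=
  mainTheorem4_general Λ κ ε hΛ hκ hε S Γ Ω hbg hΩ h₁ h₂ hh₁ hh₂ hasd₁.1 hasd₂.1
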